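/- Let $C=[0,1]^2$ with vertices $x_0=(0,0)$, $x_1=(1,0)$, $x_2=(0,1)$, $x_3=(1,1)$. For $X\subseteq\mathbb{R}^2$, $a>0$ and $z\in a\mathbb{Z}^2$, let $l(X,a,z)=\sum_{i=0}^{3}2^i\,1_{\{z+ax_i\in X\}}\in\{0,\dots,15\}$ be the index of the black/white configuration of $X$ on the vertices of the cell $z+aC$. The six classes of configurations up to rigid motions are $\eta_1=\{0\}$ (all vertices white), $\eta_2=\{1,2,4,8\}$, $\eta_3=\{3,5,10,12\}$, $\eta_4=\{6,9\}$, $\eta_5=\{7,11,13,14\}$, $\eta_6=\{15\}$ (all vertices black). Let $W\subseteq\mathbb{R}^2$ be a compact convex window with non-empty interior, let $N_0$ be the number of $z\in a\mathbb{Z}^2$ with $z+aC\subseteq W$, and let $N_j$ be the number of those $z$ with $l(X,a,z)\in\eta_j$. For real weights $w^{(2)}=(w_1^{(2)},\dots,w_6^{(2)})$ (independent of $a$) put $$\hat V_2(X)=\sum_{j=1}^{6}w_j^{(2)}\frac{N_j}{N_0}.$$ Let $\mu$ be a probability measure on $\mathbb{R}$ with $\mu([\varepsilon,\infty))=1$ for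 some $\varepsilon>0$ and $\int r^2\,\mu(dr)<\infty$. For $\gamma>0$, the ball-grain Boolean model with intensity $\gamma$ and radius law $\mu$ is the random set $\Xi=\bigcup_i (x_i+B(r_i))$, where $\{x_1,x_2,\dots\}$ is a stationary Poisson process in $\mathbb{R}^2$ with intensity $\gamma$ and, independently of it, $r_1,r_2,\dots$ are i.i.d. with law $\mu$; here $B(r)$ is the closed ball of radius $r$ centred at $0$. Its specific area is $\overline{V}_2(\Xi)=\lim_{t\to\infty}E V_2(\Xi\cap tK)/V_2(tK)$, where $V_2$ denotes area and $K$ is any compact convex set with non-empty interior. The estimator $\hat V_2$ is called asymptotically unbiased for $\Xi$ if $\overline{V}_2(\Xi)$ exists (the limit is the same for all $K$) and $\lim_{a\to0^+}E\hat V_2(\Xi)=\overline{V}_2(\Xi)$. **Proposition.** Let $W$ and $\mu$ be as above. Then $\hat V_2$ with weights $w^{(2)}$ is asymptotically unbiased for the ball-grain Boolean models $\Xi$ of every intensity $\gamma>0$ (with radius law $\mu$) if and only if $w_1^{(2)}=0$ and $w_6^{(2)}=1$. -/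

import Mathlib

open MeasureTheory ProbabilityTheory Filter Topology
open scoped ENNReal NNReal Pointwise

universe u

namespace BooleanModel

/-- The Euclidean plane. -/
abbrev Plane : Type := EuclideanSpace ℝ (Fin 2)

/-! ### Configurations and the local estimators -/

/-- The vertices `x₀ = (0,0)`, `x₁ = (1,0)`, `x₂ = (0,1)`, `x₃ = (1,1)` of the unit square. -/
noncomputable def vertex : Fin 4 → Plane :=
  ![!₂[0, 0], !₂[1, 0], !₂[0, 1], !₂[1, 1]]

/-- The unit square `C = [0,1] × [0,1]`. -/
def unitSquare : Set Plane := {c | ∀ k, 0 ≤ c k ∧ c k ≤ 1}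

open Classical in
/-- The index `l = ∑ᵢ 2ⁱ 1{z + a xᵢ ∈ X}` of the configuration `ξ_l` which the set `X` shows on the
vertices of the cell `z + a C`. -/
noncomputable def configIndex (X : Set Plane) (a : ℝ) (z : Plane) : ℕ :=
  ∑ i : Fin 4, if z + a • vertex i ∈ X then 2 ^ (i : ℕ) else 0

/-- The six classes `η₁, …, η₆` of configurations up to rigid motions, as sets of indices `l`;
the class `η_{j+1}` is `configClass j`. -/
def configClass : Fin 6 → Finset ℕ :=
  ![{0}, {1, 2, 4, 8}, {3, 5, 10, 12}, {6, 9}, {7, 11, 13, 14}, {15}]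

/-- The lattice points `z ∈ aℤ²` whose cell `z + a C` is contained in the window `W`. -/
def sites (a : ℝ) (W : Set Plane) : Set Plane :=
  {z | (∃ m : Fin 2 → ℤ, ∀ k, z k = a * (m k : ℝ)) ∧ ∀ c ∈ unitSquare, z + a • c ∈ W}

/-- `N_{j+1}`: the number of cells in the window on which `X` shows a configuration of the class
`η_{j+1}`. -/
noncomputable def configCount (a : ℝ) (W X : Set Plane) (j : Fin 6) : ℕ :=
  {z ∈ sites a W | configIndex X a z ∈ configClass j}.ncard

/-- The local estimator `a^{i-2} ∑ⱼ wⱼ Nⱼ / N₀` of the specific `i`-th intrinsic volume, where `N₀`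
is the number of cells in the window; the weight `w_{j+1}` of the class `η_{j+1}` is `w j`. -/
noncomputable def localEstimator (i : ℕ) (w : Fin 6 → ℝ) (a : ℝ) (W X : Set Plane) : ℝ :=
  a ^ ((i : ℤ) - 2) * ∑ j, w j * ((configCount a W X j : ℝ) / ((sites a W).ncard : ℝ))

section Random

variable {Ω : Type u} [MeasurableSpace Ω]

/-! ### Boolean models with balls as grains -/

/-- The number of points of the sequence `x₀, x₁, …` that lie in `A`. -/
noncomputable def pointCount (x : ℕ → Ω → Plane) (A : Set Plane) (ω : Ω) : ℕ∞ :=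
  {i | x i ω ∈ A}.encard

/-- The random points `x₀, x₁, …` form a stationary Poisson point process in the plane with
intensity `γ`: the number of points in a Borel set `A` of finite area is Poisson distributed with
mean `γ · area(A)`, and the numbers of points in disjoint sets are independent. -/
structure IsStationaryPoisson (P : Measure Ω) (γ : ℝ≥0) (x : ℕ → Ω → Plane) : Prop where
  measurable : ∀ i, Measurable (x i)
  count_law : ∀ A : Set Plane, MeasurableSet A → volume A < ∞ → ∀ k : ℕ,
    P {ω | pointCount x A ω = k} = poissonMeasure (γ * (volume A).toNNReal) {k}
  count_indep : ∀ (n : ℕ) (A : Fin n → Set Plane), (∀ k, MeasurableSet (A k)) →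
    (∀ k, volume (A k) < ∞) → Pairwise (fun k l => Disjoint (A k) (A l)) →
    iIndepFun (fun k => pointCount x (A k)) P

/-- The centres `xᵢ` and radii `rᵢ` of a Boolean model with intensity `γ` whose grains are the
balls `B(rᵢ)`: the centres form a stationary Poisson process with intensity `γ`, the radii are
i.i.d. with law `μ`, and the sequence of radii is independent of the sequence of centres. -/
structure IsBallModel (P : Measure Ω) (γ : ℝ≥0) (μ : Measure ℝ)
    (x : ℕ → Ω → Plane) (r : ℕ → Ω → ℝ) : Prop where
  centres : IsStationaryPoisson P γ x
  radius_measurable : ∀ i, Measurable (r i)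
  radius_law : ∀ i, P.map (r i) = μ
  radius_indep : iIndepFun r P
  centre_radius_indep : IndepFun (fun ω i => x i ω) (fun ω i => r i ω) P

/-- The random set `Ξ = ⋃ᵢ (xᵢ + B(rᵢ))`. -/
def ballUnion (x : ℕ → Ω → Plane) (r : ℕ → Ω → ℝ) (ω : Ω) : Set Plane :=
  ⋃ i, Metric.closedBall (x i ω) (r i ω)

/-! ### Specific area and asymptotic unbiasedness -/

/-- `v` is the specific area of the random set `Ξ`, that is, `v = lim E V₂(Ξ ∩ tK) / V₂(tK)` as
`t → ∞`, for every compact convex set `K` with non-empty interior. -/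
def HasSpecificArea (P : Measure Ω) (Ξ : Ω → Set Plane) (v : ℝ) : Prop :=
  ∀ K : Set Plane, IsCompact K → Convex ℝ K → (interior K).Nonempty →
    Tendsto (fun t : ℝ => (∫ ω, volume.real (Ξ ω ∩ t • K) ∂P) / volume.real (t • K))
      atTop (𝓝 v)

/-- The local estimator of the specific area with weights `w`, observed in the window `W`, is
asymptotically unbiased for the random set `Ξ`: its mean converges to the specific area of `Ξ` as
the lattice distance `a` tends to zero. -/
def IsAsymptoticallyUnbiasedArea (P : Measure Ω) (Ξ : Ω → Set Plane) (W : Set Plane)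
    (w : Fin 6 → ℝ) : Prop :=
  ∃ v : ℝ, HasSpecificArea P Ξ v ∧
    Tendsto (fun a : ℝ => ∫ ω, localEstimator 2 w a W (Ξ ω) ∂P) (𝓝[>] 0) (𝓝 v)

end Random

end BooleanModel

/-! A fixed point is covered by `Ξ` with probability p = 1 - exp(-γ c), where c is the mean area of
a grain. By Fubini the mean area of `Ξ ∩ A` is p times the area of A, so p is also the specific area
(`IsBallModel.hasSpecificArea`).

As the mesh a tends to 0, the four vertices of a cell merge. Two points at distance d have different
colours with probability O(d), so mixed configurations disappear in the limit. A cell is then all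
black with probability tending to p and all white with probability tending to 1 - p, uniformly over
the cells. Hence the mean of the estimator tends to w₁(1 - p) + w₆ p
(`IsBallModel.tendsto_integral_localEstimator`), and unbiasedness means w₁ + (w₆ - w₁ - 1) p = 0.
Since 0 < c < ∞, different intensities give different p, and an affine function with two zeros
vanishes identically.

Both one- and two-point estimates come from the formula exp(-γ Λ(D)) for the probability that no
centre-radius pair falls in D, with Λ the product of area and `μ`
(`IsBallModel.measure_forall_notMem`). It follows from the generating functional of the Poisson
process.

The "only if" direction also needs a ball model for the intensities it uses, since otherwise the
hypothesis could hold vacuously. The second half constructs one from Poisson numbers of independent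
points in countably many cells, identified as a Poisson process by characteristic functions. -/

namespace BooleanModel

/-! ### Generating functions of the Poisson distribution -/

/-- Complex arguments are needed for the characteristic functions in the construction; real ones in
[0, 1] serve the void probabilities. -/
lemma integral_pow_poissonMeasure (l : ℝ≥0) (z : ℂ) :
    ∫ n, z ^ n ∂(poissonMeasure l) = Complex.exp (l * (z - 1)) := by
  rw [integral_poissonMeasure l]
  calc ∑' a : ℕ, (Real.exp (-l) * l ^ a / a.factorial : ℝ) • z ^ a
      = ∑' a : ℕ, (Real.exp (-l) : ℂ) * ((l * z) ^ a / a.factorial) := by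
        congr with a
        rw [Complex.real_smul, mul_pow]
        push_cast
        ring
    _ = Real.exp (-l) * ∑' a : ℕ, ((l * z) ^ a / a.factorial) := tsum_mul_left
    _ = Real.exp (-l) * Complex.exp (l * z) := by
        rw [(NormedSpace.expSeries_div_hasSum_exp ((l : ℂ) * z)).tsum_eq, Complex.exp_eq_exp_ℂ]
    _ = Complex.exp (l * (z - 1)) := by
        rw [Complex.ofReal_exp, ← Complex.exp_add]
        push_cast
        ring_nf

lemma lintegral_one_sub_pow_poissonMeasure (l : ℝ≥0) {c : ℝ≥0∞} (hc : c ≤ 1) :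
    ∫⁻ n, (1 - c) ^ n ∂(poissonMeasure l) = ENNReal.ofReal (Real.exp (-(l * c.toReal))) := by
  have hct : c ≠ ∞ := ne_top_of_le_ne_top ENNReal.one_ne_top hc
  have hc1 : c.toReal ≤ 1 := by
    simpa using ENNReal.toReal_mono ENNReal.one_ne_top hc
  have hq : 1 - c = ENNReal.ofReal (1 - c.toReal) := by
    rw [ENNReal.ofReal_sub _ ENNReal.toReal_nonneg, ENNReal.ofReal_toReal hct, ENNReal.ofReal_one]
  have hq0 : 0 ≤ 1 - c.toReal := by linarith
  have h1 : ∀ n : ℕ, (1 - c) ^ n = ENNReal.ofReal ((1 - c.toReal) ^ n) := fun n => by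
    rw [hq, ENNReal.ofReal_pow hq0]
  simp_rw [h1]
  rw [← ofReal_integral_eq_lintegral_ofReal]
  · congr 1
    have h2 := integral_pow_poissonMeasure l ((1 - c.toReal : ℝ) : ℂ)
    have h3 : ∀ n : ℕ, ((1 - c.toReal : ℝ) : ℂ) ^ n = (((1 - c.toReal) ^ n : ℝ) : ℂ) := by
      intro n; push_cast; rfl
    simp_rw [h3] at h2
    rw [integral_complex_ofReal] at h2
    apply Complex.ofReal_injective
    rw [h2]
    push_cast
    ring_nf
  · refine Integrable.of_bound (C := 1) (by fun_prop) (ae_of_all _ fun n => ?_)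
    rw [Real.norm_of_nonneg (by positivity)]
    exact pow_le_one₀ hq0 (by linarith [ENNReal.toReal_nonneg (a := c)])
  · exact ae_of_all _ fun n => by positivity

/-! ### Counting variables of a Poisson process -/

section Counts

lemma pointCount_toENNReal {Ω : Type u} (x : ℕ → Ω → Plane) (A : Set Plane) (ω : Ω) :
    (pointCount x A ω : ℝ≥0∞) = ∑' i, A.indicator 1 (x i ω) := by
  rw [pointCount, ← ENNReal.tsum_set_one, tsum_subtype {i | x i ω ∈ A} (fun _ => (1 : ℝ≥0∞))]
  rfl

variable {Ω : Type u} [MeasurableSpace Ω] {P : Measure Ω} {x : ℕ → Ω → Plane}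

lemma measurable_pointCount (hx : ∀ i, Measurable (x i)) {A : Set Plane} (hA : MeasurableSet A) :
    Measurable (pointCount x A) := by
  have h : Measurable fun ω => (pointCount x A ω : ℝ≥0∞) := by
    simp_rw [pointCount_toENNReal]
    exact Measurable.tsum fun i => (measurable_one.indicator hA).comp (hx i)
  refine measurable_to_countable' fun k => ?_
  have : pointCount x A ⁻¹' {k} = (fun ω => (pointCount x A ω : ℝ≥0∞)) ⁻¹' {(k : ℝ≥0∞)} := by
    ext ω
    simp
  rw [this]
  exact h (measurableSet_singleton _)

/-- `count_law` prescribes only the masses of finite values. These already sum to one, so nothing is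
left for `⊤`. -/
lemma IsStationaryPoisson.map_pointCount [IsProbabilityMeasure P] {γ : ℝ≥0}
    (hx : IsStationaryPoisson P γ x) {A : Set Plane} (hA : MeasurableSet A)
    (hvol : volume A < ∞) :
    P.map (pointCount x A) =
      (poissonMeasure (γ * (volume A).toNNReal)).map (fun n : ℕ => (n : ℕ∞)) := by
  have hm := measurable_pointCount hx.measurable hA
  have := Measure.isProbabilityMeasure_map (μ := P) hm.aemeasurable
  have hc : Measurable (fun n : ℕ => (n : ℕ∞)) := by fun_prop
  have := Measure.isProbabilityMeasure_map
    (μ := poissonMeasure (γ * (volume A).toNNReal)) hc.aemeasurable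
  have hfin : ∀ k : ℕ, P.map (pointCount x A) {(k : ℕ∞)} =
      (poissonMeasure (γ * (volume A).toNNReal)).map (fun n : ℕ => (n : ℕ∞)) {(k : ℕ∞)} := by
    intro k
    rw [Measure.map_apply hm (measurableSet_singleton _),
      Measure.map_apply hc (measurableSet_singleton _)]
    have h1 : (fun n : ℕ => (n : ℕ∞)) ⁻¹' {(k : ℕ∞)} = {k} := by ext n; simp
    rw [h1, ← hx.count_law A hA hvol k]
    rfl
  have hrange : P.map (pointCount x A) (Set.range fun k : ℕ => (k : ℕ∞)) =
      (poissonMeasure (γ * (volume A).toNNReal)).map (fun n : ℕ => (n : ℕ∞))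
        (Set.range fun k : ℕ => (k : ℕ∞)) := by
    rw [← Set.iUnion_singleton_eq_range, measure_iUnion, measure_iUnion]
    · exact tsum_congr hfin
    · intro i j hij; simpa using hij
    · intro i; exact measurableSet_singleton _
    · intro i j hij; simpa using hij
    · intro i; exact measurableSet_singleton _
  refine Measure.ext_iff_singleton.2 fun k => ?_
  induction k using ENat.recTopCoe with
  | coe k => exact hfin k
  | top =>
    have htop : ({⊤} : Set ℕ∞) = (Set.range fun k : ℕ => (k : ℕ∞))ᶜ := by
      ext k
      induction k using ENat.recTopCoe <;> simp
    rw [htop, prob_compl_eq_one_sub .of_discrete, prob_compl_eq_one_sub .of_discrete, hrange]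

lemma IsStationaryPoisson.ae_pointCount_ne_top [IsProbabilityMeasure P] {γ : ℝ≥0}
    (hx : IsStationaryPoisson P γ x) {A : Set Plane} (hA : MeasurableSet A)
    (hvol : volume A < ∞) : ∀ᵐ ω ∂P, pointCount x A ω ≠ ⊤ := by
  have h : P.map (pointCount x A) {⊤} = 0 := by
    rw [hx.map_pointCount hA hvol, Measure.map_apply (by fun_prop) .of_discrete]
    have : (fun n : ℕ => (n : ℕ∞)) ⁻¹' {⊤} = ∅ := by ext n; simp
    simp [this]
  rw [Measure.map_apply (measurable_pointCount hx.measurable hA) .of_discrete] at h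
  rw [ae_iff]
  convert h using 2
  ext ω
  simp

lemma IsStationaryPoisson.lintegral_pow_pointCount [IsProbabilityMeasure P] {γ : ℝ≥0}
    (hx : IsStationaryPoisson P γ x) {A : Set Plane} (hA : MeasurableSet A)
    (hvol : volume A < ∞) {c : ℝ≥0∞} (hc : c ≤ 1) :
    ∫⁻ ω, (1 - c) ^ (pointCount x A ω).toNat ∂P =
      ENNReal.ofReal (Real.exp (-(γ * ((volume A).toReal * c.toReal)))) := by
  have h1 : ∫⁻ ω, (1 - c) ^ (pointCount x A ω).toNat ∂P =
      ∫⁻ k : ℕ∞, (1 - c) ^ k.toNat ∂(P.map (pointCount x A)) := by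
    rw [lintegral_map .of_discrete (measurable_pointCount hx.measurable hA)]
  rw [h1, hx.map_pointCount hA hvol, lintegral_map .of_discrete (by fun_prop)]
  simp_rw [ENat.toNat_natCast]
  rw [lintegral_one_sub_pow_poissonMeasure _ hc]
  congr 3
  rw [NNReal.coe_mul, mul_assoc]
  rfl

end Counts

/-! ### The probability generating functional -/

lemma eventually_prod_range_ite_eq {M : Type*} [CommMonoid M] (p : ℕ → Prop) [DecidablePred p]
    (hp : {i | p i}.encard ≠ ⊤) (q : M) :
    ∀ᶠ m in atTop, ∏ i ∈ Finset.range m, (if p i then q else 1) = q ^ {i | p i}.encard.toNat := by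
  have hfin : {i | p i}.Finite := Set.encard_ne_top_iff.1 hp
  obtain ⟨b, hb⟩ := hfin.bddAbove
  filter_upwards [eventually_gt_atTop b] with m hm
  have h1 : (Finset.range m).filter p = hfin.toFinset := by
    ext i
    simp only [Finset.mem_filter, Finset.mem_range, Set.Finite.mem_toFinset, Set.mem_ofPred_eq,
      and_iff_right_iff_imp]
    exact fun hi => (hb hi).trans_lt hm
  rw [Finset.prod_ite, Finset.prod_const, Finset.prod_const_one, mul_one, h1,
    hfin.encard_eq_coe_toFinset_card, ENat.toNat_natCast]

lemma antitone_prod_range_of_le_one {f : ℕ → ℝ≥0∞} (hf : ∀ i, f i ≤ 1) :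
    Antitone fun m => ∏ i ∈ Finset.range m, f i := by
  refine antitone_nat_of_succ_le fun m => ?_
  rw [Finset.prod_range_succ]
  exact mul_le_of_le_one_right' (hf m)

section Functional

variable {Ω : Type u} [MeasurableSpace Ω] {P : Measure Ω} [IsProbabilityMeasure P]
  {x : ℕ → Ω → Plane} {γ : ℝ≥0}

/-- Each point in the level set {s = c} contributes a factor 1 - c, so the product over the points
is a finite product of powers (1 - c)^N with N the count in that level set. The level sets are
disjoint, hence the counts are independent and the Poisson generating function applies to each. The
infinite product is written as the infimum of its decreasing partial products. -/
lemma IsStationaryPoisson.lintegral_prod_simpleFunc (hx : IsStationaryPoisson P γ x)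
    (s : SimpleFunc Plane ℝ≥0∞) (hs : ∀ y, s y ≤ 1) (hfin : ∫⁻ y, s y ≠ ∞) :
    ∫⁻ ω, ⨅ m, ∏ i ∈ Finset.range m, (1 - s (x i ω)) ∂P =
      ENNReal.ofReal (Real.exp (-(γ * (∫⁻ y, s y).toReal))) := by
  classical
  -- The value 0 contributes factors 1, and its level set has infinite area, so it is left out.
  set T : Finset ℝ≥0∞ := s.range.filter (· ≠ 0) with hT
  have hT0 : ∀ c ∈ T, c ≠ 0 := fun c hc => (Finset.mem_filter.1 hc).2
  have hT1 : ∀ c ∈ T, c ≤ 1 := fun c hc => by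
    obtain ⟨y, hy⟩ := SimpleFunc.mem_range.1 (Finset.mem_filter.1 hc).1
    exact hy ▸ hs y
  have hA : ∀ c, MeasurableSet (s ⁻¹' {c}) := fun c => s.measurableSet_preimage _
  have hvol : ∀ c ∈ T, volume (s ⁻¹' {c}) < ∞ := fun c hc => by
    have h1 : c * volume {y | c ≤ s y} ≤ ∫⁻ y, s y :=
      mul_meas_ge_le_lintegral s.measurable c
    have h2 : volume {y | c ≤ s y} ≠ ∞ := fun h => by
      rw [h, ENNReal.mul_top (hT0 c hc)] at h1
      exact hfin (top_le_iff.1 h1)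
    have h3 : s ⁻¹' {c} ⊆ {y | c ≤ s y} := fun y hy => (Set.mem_singleton_iff.1 hy).ge
    exact (measure_mono h3).trans_lt h2.lt_top
  have hind : iIndepFun (fun c : T => pointCount x (s ⁻¹' {(c : ℝ≥0∞)})) P := by
    let e := Fintype.equivFin T
    have := hx.count_indep _ (fun k => s ⁻¹' {((e.symm k : T) : ℝ≥0∞)}) (fun k => hA _)
      (fun k => hvol _ (e.symm k).2) (fun k l hkl => by
        refine Disjoint.preimage _ (Set.disjoint_singleton.2 fun h => hkl ?_)
        exact e.symm.injective (Subtype.ext h))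
    simpa using this.precomp e.injective
  have hpath : ∀ᵐ ω ∂P, ⨅ m, ∏ i ∈ Finset.range m, (1 - s (x i ω)) =
      ∏ c : T, (1 - (c : ℝ≥0∞)) ^ (pointCount x (s ⁻¹' {(c : ℝ≥0∞)}) ω).toNat := by
    have hN : ∀ᵐ ω ∂P, ∀ c : T, pointCount x (s ⁻¹' {(c : ℝ≥0∞)}) ω ≠ ⊤ :=
      ae_all_iff.2 fun c => hx.ae_pointCount_ne_top (hA c) (hvol c c.2)
    filter_upwards [hN] with ω hω
    have hfac : ∀ m, ∏ i ∈ Finset.range m, (1 - s (x i ω)) =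
        ∏ c : T, ∏ i ∈ Finset.range m,
          (if x i ω ∈ s ⁻¹' {(c : ℝ≥0∞)} then 1 - (c : ℝ≥0∞) else 1) := by
      intro m
      rw [Finset.prod_comm]
      refine Finset.prod_congr rfl fun i _ => ?_
      rw [Finset.prod_coe_sort T
        (fun c => if x i ω ∈ s ⁻¹' {c} then 1 - c else 1)]
      simp only [Set.mem_preimage, Set.mem_singleton_iff, Finset.prod_ite_eq]
      split_ifs with h
      · rfl
      · have : s (x i ω) = 0 := by
          by_contra h0
          exact h (Finset.mem_filter.2 ⟨SimpleFunc.mem_range_self _ _, h0⟩)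
        simp [this]
    have hev : ∀ᶠ m in atTop, ∏ i ∈ Finset.range m, (1 - s (x i ω)) =
        ∏ c : T, (1 - (c : ℝ≥0∞)) ^ (pointCount x (s ⁻¹' {(c : ℝ≥0∞)}) ω).toNat := by
      have := eventually_all.2 fun c : T =>
        eventually_prod_range_ite_eq (fun i => x i ω ∈ s ⁻¹' {(c : ℝ≥0∞)}) (hω c)
          (1 - (c : ℝ≥0∞))
      filter_upwards [this] with m hm
      rw [hfac]
      exact Finset.prod_congr rfl fun c _ => hm c
    exact tendsto_nhds_unique
      (tendsto_atTop_iInf (antitone_prod_range_of_le_one fun i => tsub_le_self))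
      (tendsto_const_nhds.congr' (hev.mono fun _ h => h.symm))
  rw [lintegral_congr_ae hpath,
    lintegral_prod_eq_prod_lintegral_of_indepFun Finset.univ
      (fun (c : T) ω => (1 - (c : ℝ≥0∞)) ^ (pointCount x (s ⁻¹' {(c : ℝ≥0∞)}) ω).toNat)
      (hind.comp (fun (c : T) k => (1 - (c : ℝ≥0∞)) ^ k.toNat) fun c => .of_discrete)
      (fun c => Measurable.comp (g := fun k : ℕ∞ => (1 - (c : ℝ≥0∞)) ^ k.toNat) .of_discrete
        (measurable_pointCount hx.measurable (hA c)))]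
  rw [Finset.prod_congr rfl fun (c : T) _ =>
    hx.lintegral_pow_pointCount (hA c) (hvol c c.2) (hT1 c c.2)]
  rw [← ENNReal.ofReal_prod_of_nonneg (fun _ _ => by positivity), ← Real.exp_sum]
  congr 2
  rw [Finset.sum_neg_distrib, ← Finset.mul_sum, Finset.sum_coe_sort T
    (fun c => (volume (s ⁻¹' {c})).toReal * c.toReal)]
  congr 2
  rw [SimpleFunc.lintegral_eq_lintegral, SimpleFunc.lintegral]
  rw [← Finset.sum_filter_of_ne (s := s.range) (f := fun c => c * volume (s ⁻¹' {c})) (p := (· ≠ 0))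
    (fun c _ h h0 => h (by simp [h0])), ← hT,
    ENNReal.toReal_sum fun c hc => ENNReal.mul_ne_top
      (ne_top_of_le_ne_top ENNReal.one_ne_top (hT1 c hc)) (hvol c hc).ne]
  exact Finset.sum_congr rfl fun c _ => by rw [ENNReal.toReal_mul, mul_comm]

/-- The probability generating functional of a stationary Poisson process. -/
theorem IsStationaryPoisson.lintegral_prod (hx : IsStationaryPoisson P γ x)
    {g : Plane → ℝ≥0∞} (hg : Measurable g) (hg1 : ∀ y, g y ≤ 1) (hfin : ∫⁻ y, g y ≠ ∞) :
    ∫⁻ ω, ⨅ m, ∏ i ∈ Finset.range m, (1 - g (x i ω)) ∂P =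
      ENNReal.ofReal (Real.exp (-(γ * (∫⁻ y, g y).toReal))) := by
  set s : ℕ → SimpleFunc Plane ℝ≥0∞ := SimpleFunc.eapprox g with hs
  have hmono : Monotone s := SimpleFunc.monotone_eapprox g
  have hsup : ∀ y, ⨆ n, s n y = g y := SimpleFunc.iSup_eapprox_apply hg
  have hle : ∀ n y, s n y ≤ g y := fun n y => (hsup y) ▸ le_iSup (fun n => s n y) n
  have hlim : ∀ y, Tendsto (fun n => s n y) atTop (𝓝 (g y)) := fun y =>
    hsup y ▸ tendsto_atTop_iSup fun a b hab => hmono hab y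
  have hmeas : ∀ n, Measurable fun ω => ⨅ m, ∏ i ∈ Finset.range m, (1 - s n (x i ω)) := fun n =>
    .iInf fun m => Finset.measurable_fun_prod _ fun i _ =>
      measurable_const.sub ((s n).measurable.comp (hx.measurable i))
  have hanti : Antitone fun n ω => ⨅ m, ∏ i ∈ Finset.range m, (1 - s n (x i ω)) :=
    fun a b hab ω => iInf_mono fun m => Finset.prod_le_prod' fun i _ =>
      tsub_le_tsub_left (hmono hab _) _
  -- Approximation of g from below makes the products decrease. The two infima commute, and for
  -- fixed m the finite product is continuous in its factors.
  have hstep : ∀ ω, ⨅ m, ∏ i ∈ Finset.range m, (1 - g (x i ω)) =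
      ⨅ n, ⨅ m, ∏ i ∈ Finset.range m, (1 - s n (x i ω)) := by
    intro ω
    rw [iInf_comm]
    refine iInf_congr fun m => ?_
    refine tendsto_nhds_unique ?_ (tendsto_atTop_iInf fun a b hab =>
      Finset.prod_le_prod' fun i _ => tsub_le_tsub_left (hmono hab _) _)
    refine ENNReal.tendsto_finsetProd_of_ne_top _ (fun i _ => ?_) fun i _ => ?_
    · exact ENNReal.Tendsto.sub tendsto_const_nhds (hlim _) (Or.inl ENNReal.one_ne_top)
    · exact ne_top_of_le_ne_top ENNReal.one_ne_top tsub_le_self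
  simp_rw [hstep]
  have hint : ∀ n, ∫⁻ y, s n y ≤ ∫⁻ y, g y := fun n => lintegral_mono (hle n)
  have hfin' : ∀ n, ∫⁻ y, s n y ≠ ∞ := fun n => ne_top_of_le_ne_top hfin (hint n)
  have h1 : ∀ n y, s n y ≤ 1 := fun n y => (hle n y).trans (hg1 y)
  have hval := fun n => hx.lintegral_prod_simpleFunc (s n) (h1 n) (hfin' n)
  rw [lintegral_iInf hmeas hanti (by rw [hval]; exact ENNReal.ofReal_ne_top)]
  refine tendsto_nhds_unique (tendsto_atTop_iInf fun a b hab => lintegral_mono (hanti hab)) ?_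
  simp_rw [hval]
  refine ENNReal.tendsto_ofReal ?_
  refine (Real.continuous_exp.tendsto _).comp (Tendsto.neg (Tendsto.const_mul _ ?_))
  refine (ENNReal.tendsto_toReal hfin).comp ?_
  rw [← lintegral_congr hsup, lintegral_iSup (fun n => (s n).measurable) fun a b hab y => hmono hab y]
  exact tendsto_atTop_iSup fun a b hab => lintegral_mono fun y => hmono hab y

end Functional

/-! ### Marked hitting probabilities -/

section Marked

variable {Ω : Type u} [MeasurableSpace Ω] {P : Measure Ω} [IsProbabilityMeasure P]
  {x : ℕ → Ω → Plane} {r : ℕ → Ω → ℝ} {γ : ℝ≥0} {μ : Measure ℝ}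

lemma IsBallModel.map_centre_radius (h : IsBallModel P γ μ x r) :
    P.map (fun ω => ((fun i => x i ω), fun i => r i ω)) =
      (P.map fun ω i => x i ω).prod (Measure.infinitePi fun _ : ℕ => μ) := by
  have hxm : Measurable fun ω i => x i ω := measurable_pi_lambda _ h.centres.measurable
  have hrm : Measurable fun ω i => r i ω := measurable_pi_lambda _ h.radius_measurable
  rw [(indepFun_iff_map_prod_eq_prod_map_map hxm.aemeasurable hrm.aemeasurable).1
    h.centre_radius_indep, h.radius_indep.map_fun_eq_infinitePi_map h.radius_measurable]
  simp_rw [h.radius_law]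

/-- The probability that no centre-radius pair lies in a given set. -/
theorem IsBallModel.measure_forall_notMem [IsProbabilityMeasure μ] (h : IsBallModel P γ μ x r) {D : Set (Plane × ℝ)}
    (hD : MeasurableSet D) (hfin : (volume.prod μ) D ≠ ∞) :
    P {ω | ∀ i, (x i ω, r i ω) ∉ D} =
      ENNReal.ofReal (Real.exp (-(γ * ((volume.prod μ) D).toReal))) := by
  have hxm : Measurable fun ω i => x i ω := measurable_pi_lambda _ h.centres.measurable
  have hrm : Measurable fun ω i => r i ω := measurable_pi_lambda _ h.radius_measurable
  have hsec : ∀ y, MeasurableSet (Prod.mk y ⁻¹' D) := fun y => measurable_prodMk_left hD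
  set g : Plane → ℝ≥0∞ := fun y => μ (Prod.mk y ⁻¹' D) with hg
  have hgm : Measurable g := measurable_measure_prodMk_left hD
  have hgint : ∫⁻ y, g y = (volume.prod μ) D := (Measure.prod_apply hD).symm
  -- Only the first m pairs are tested. Given the centres, the radii are i.i.d., so this event has
  -- conditional probability ∏ (1 - g(xᵢ)); m → ∞ then leads to the generating functional.
  set S : ℕ → Set ((ℕ → Plane) × (ℕ → ℝ)) := fun m => {q | ∀ i < m, (q.1 i, q.2 i) ∉ D} with hS
  have hSm : ∀ m, MeasurableSet (S m) := fun m => by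
    have : S m = ⋂ i, ⋂ (_ : i < m), (fun q => (q.1 i, q.2 i)) ⁻¹' Dᶜ := by
      ext q; simp [hS]
    rw [this]
    exact .iInter fun i => .iInter fun _ =>
      (by fun_prop : Measurable fun q : (ℕ → Plane) × (ℕ → ℝ) => (q.1 i, q.2 i)) hD.compl
  have hSanti : Antitone S := fun a b hab q hq i hi => hq i (hi.trans_le hab)
  have hstep : ∀ m, P ((fun ω => ((fun i => x i ω), fun i => r i ω)) ⁻¹' S m) =
      ∫⁻ ω, ∏ i ∈ Finset.range m, (1 - g (x i ω)) ∂P := by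
    intro m
    rw [← Measure.map_apply (hxm.prodMk hrm) (hSm m), h.map_centre_radius,
      Measure.prod_apply (hSm m), lintegral_map (measurable_measure_prodMk_left (hSm m)) hxm]
    refine lintegral_congr fun ω => ?_
    have : Prod.mk (fun i => x i ω) ⁻¹' S m =
        ((Finset.range m : Finset ℕ) : Set ℕ).pi fun i => (Prod.mk (x i ω) ⁻¹' D)ᶜ := by
      ext q; simp [hS, Set.mem_pi]
    rw [this, Measure.infinitePi_pi _ fun i _ => (hsec _).compl]
    exact Finset.prod_congr rfl fun i _ => prob_compl_eq_one_sub (hsec _)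
  have hset : {ω | ∀ i, (x i ω, r i ω) ∉ D} =
      ⋂ m, (fun ω => ((fun i => x i ω), fun i => r i ω)) ⁻¹' S m := by
    ext ω
    simp only [hS, Set.mem_ofPred_eq, Set.mem_iInter, Set.mem_preimage]
    exact ⟨fun h m i _ => h i, fun h i => h (i + 1) i (Nat.lt_succ_self i)⟩
  rw [hset, Antitone.measure_iInter (fun a b hab => Set.preimage_mono (hSanti hab))
    (fun m => (hxm.prodMk hrm (hSm m)).nullMeasurableSet) ⟨0, measure_ne_top _ _⟩, ← hgint,
    ← h.centres.lintegral_prod hgm (fun y => prob_le_one) (by rwa [hgint]), lintegral_iInf]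
  · exact iInf_congr hstep
  · exact fun m => Finset.measurable_fun_prod _ fun i _ =>
      measurable_const.sub (hgm.comp (h.centres.measurable i))
  · exact fun a b hab ω => antitone_prod_range_of_le_one (fun i => tsub_le_self) hab
  · simp

end Marked

/-! ### Mean areas of the grains -/

/-- The mean area of a ball whose radius has law `μ`. -/
noncomputable def meanBallArea (μ : Measure ℝ) : ℝ≥0∞ :=
  ∫⁻ s, volume (Metric.closedBall (0 : Plane) s) ∂μ

/-- The pairs of centres and radii of the balls which contain the point `z`. -/
def coveringPairs (z : Plane) : Set (Plane × ℝ) := {q | dist z q.1 ≤ q.2}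

lemma measurableSet_coveringPairs (z : Plane) : MeasurableSet (coveringPairs z) :=
  measurableSet_le (by fun_prop) (by fun_prop)

lemma volume_closedBall_plane (z : Plane) (s : ℝ) :
    volume (Metric.closedBall z s) = ENNReal.ofReal s ^ 2 * ENNReal.ofReal Real.pi := by
  rw [EuclideanSpace.volume_closedBall_fin_two]

lemma preimage_coveringPairs (z : Plane) (s : ℝ) :
    (fun y => (y, s)) ⁻¹' coveringPairs z = Metric.closedBall z s := by
  ext y
  simp [coveringPairs, dist_comm]

section MeanArea

variable {μ : Measure ℝ} [IsProbabilityMeasure μ]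

/-- The section at radius s is the ball of radius s about z, whose area does not depend on z. This
makes the coverage probability the same at every point. -/
lemma measure_coveringPairs (z : Plane) :
    (volume.prod μ) (coveringPairs z) = meanBallArea μ := by
  rw [Measure.prod_apply_symm (measurableSet_coveringPairs z), meanBallArea]
  simp_rw [preimage_coveringPairs, volume_closedBall_plane]

omit [IsProbabilityMeasure μ] in
lemma meanBallArea_ne_top (hμ : Integrable (fun r : ℝ => r ^ 2) μ) : meanBallArea μ ≠ ∞ := by
  have h1 : meanBallArea μ ≤ ∫⁻ s, ENNReal.ofReal (s ^ 2) * ENNReal.ofReal Real.pi ∂μ := by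
    refine lintegral_mono fun s => ?_
    rw [volume_closedBall_plane]
    gcongr
    rcases le_total 0 s with hs | hs
    · rw [ENNReal.ofReal_pow hs]
    · simp [ENNReal.ofReal_of_nonpos hs]
  refine ne_top_of_le_ne_top ?_ h1
  rw [lintegral_mul_const' _ _ ENNReal.ofReal_ne_top,
    ← ofReal_integral_eq_lintegral_ofReal hμ (ae_of_all _ fun s => sq_nonneg s)]
  exact ENNReal.mul_ne_top ENNReal.ofReal_ne_top ENNReal.ofReal_ne_top

lemma meanBallArea_pos (hμ : ∃ ε : ℝ, 0 < ε ∧ ∀ᵐ r ∂μ, ε ≤ r) : 0 < meanBallArea μ := by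
  obtain ⟨ε, hε, h⟩ := hμ
  have h1 : volume (Metric.closedBall (0 : Plane) ε) ≤ meanBallArea μ := by
    rw [meanBallArea]
    calc volume (Metric.closedBall (0 : Plane) ε)
        = ∫⁻ _, volume (Metric.closedBall (0 : Plane) ε) ∂μ := by simp
      _ ≤ _ := lintegral_mono_ae (h.mono fun s hs =>
          measure_mono (Metric.closedBall_subset_closedBall hs))
  exact (Metric.measure_closedBall_pos volume _ hε).trans_le h1

/-- A bound for the mean area of the part of the typical ball that is lost by a translation of
length at most `d`. -/
noncomputable def shiftBound (μ : Measure ℝ) (d : ℝ) : ℝ :=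
  Real.pi * (2 * d * (1 + ∫ s, s ^ 2 ∂μ) + d ^ 2)

omit [IsProbabilityMeasure μ] in
lemma tendsto_shiftBound (μ : Measure ℝ) : Tendsto (shiftBound μ) (𝓝 0) (𝓝 0) := by
  have : Continuous (shiftBound μ) := by unfold shiftBound; fun_prop
  simpa [shiftBound] using this.tendsto 0

omit [IsProbabilityMeasure μ] in
lemma shiftBound_nonneg {d : ℝ} (hd : 0 ≤ d) : 0 ≤ shiftBound μ d := by
  have : 0 ≤ ∫ s, s ^ 2 ∂μ := integral_nonneg fun s => sq_nonneg s
  have := Real.pi_pos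
  unfold shiftBound
  positivity

/-- At radius s the lost part lies in the annulus about v between radii s and s + d, of area π(2ds +
d²). The bound s ≤ 1 + s² replaces the first moment by the second, which is the one assumed finite.
-/
lemma measure_coveringPairs_diff_le (hμpos : ∀ᵐ r ∂μ, 0 ≤ r)
    (hμ : Integrable (fun r : ℝ => r ^ 2) μ) {u v : Plane} {d : ℝ} (huv : dist u v ≤ d) :
    (volume.prod μ) (coveringPairs u \ coveringPairs v) ≤ ENNReal.ofReal (shiftBound μ d) := by
  have hd : 0 ≤ d := dist_nonneg.trans huv
  have hint : Integrable (fun s : ℝ => Real.pi * (2 * d * (1 + s ^ 2) + d ^ 2)) μ := by fun_prop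
  have hval : ∫ s, Real.pi * (2 * d * (1 + s ^ 2) + d ^ 2) ∂μ = shiftBound μ d := by
    rw [integral_const_mul, integral_add (by fun_prop) (by fun_prop), integral_const_mul,
      integral_add (by fun_prop) hμ]
    simp [shiftBound]
  rw [Measure.prod_apply_symm
    ((measurableSet_coveringPairs u).diff (measurableSet_coveringPairs v)), ← hval,
    ofReal_integral_eq_lintegral_ofReal hint (ae_of_all _ fun s => by
      have := Real.pi_pos
      simp only [Pi.zero_apply]
      positivity)]
  refine lintegral_mono_ae (hμpos.mono fun s hs => ?_)
  rw [Set.preimage_sdiff, preimage_coveringPairs, preimage_coveringPairs]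
  have h1 : Metric.closedBall u s ⊆ Metric.closedBall v (s + d) :=
    Metric.closedBall_subset_closedBall' (by linarith)
  have h2 : Metric.closedBall v s ⊆ Metric.closedBall v (s + d) :=
    Metric.closedBall_subset_closedBall (by linarith)
  calc volume (Metric.closedBall u s \ Metric.closedBall v s)
      ≤ volume (Metric.closedBall v (s + d) \ Metric.closedBall v s) :=
        measure_mono (Set.sdiff_subset_sdiff_left h1)
    _ = volume (Metric.closedBall v (s + d)) - volume (Metric.closedBall v s) :=
        measure_sdiff h2 Metric.isClosed_closedBall.measurableSet.nullMeasurableSet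
          measure_closedBall_lt_top.ne
    _ ≤ _ := by
        rw [volume_closedBall_plane, volume_closedBall_plane, ← ENNReal.ofReal_pow (by linarith),
          ← ENNReal.ofReal_pow hs, ← ENNReal.ofReal_mul (by positivity),
          ← ENNReal.ofReal_mul (by positivity), ← ENNReal.ofReal_sub _ (by positivity)]
        refine ENNReal.ofReal_le_ofReal ?_
        have h3 : s ≤ 1 + s ^ 2 := by nlinarith [sq_nonneg (s - 1)]
        have h4 : (s + d) ^ 2 - s ^ 2 ≤ 2 * d * (1 + s ^ 2) + d ^ 2 := by nlinarith
        have := mul_le_mul_of_nonneg_left h4 Real.pi_pos.le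
        linarith

end MeanArea

/-! ### One- and two-point probabilities of the Boolean model -/

section Coverage

variable {Ω : Type u} [MeasurableSpace Ω] {P : Measure Ω} {γ : ℝ≥0} {μ : Measure ℝ}
  {x : ℕ → Ω → Plane} {r : ℕ → Ω → ℝ}

/-- The probability that a given point is covered by the Boolean model. -/
noncomputable def coverageProb (γ : ℝ≥0) (μ : Measure ℝ) : ℝ :=
  1 - Real.exp (-(γ * (meanBallArea μ).toReal))

omit [MeasurableSpace Ω] in
lemma notMem_ballUnion_iff {z : Plane} {ω : Ω} :
    z ∉ ballUnion x r ω ↔ ∀ i, (x i ω, r i ω) ∉ coveringPairs z := by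
  simp [ballUnion, coveringPairs]

lemma IsBallModel.measurableSet_mem_ballUnion (h : IsBallModel P γ μ x r) :
    MeasurableSet {q : Ω × Plane | q.2 ∈ ballUnion x r q.1} := by
  have : {q : Ω × Plane | q.2 ∈ ballUnion x r q.1} =
      ⋃ i, {q : Ω × Plane | dist q.2 (x i q.1) ≤ r i q.1} := by
    ext q
    simp [ballUnion]
  rw [this]
  refine .iUnion fun i => measurableSet_le ?_ ?_
  · exact measurable_snd.dist ((h.centres.measurable i).comp measurable_fst)
  · exact (h.radius_measurable i).comp measurable_fst

lemma IsBallModel.measurableSet_setOf_mem (h : IsBallModel P γ μ x r) (z : Plane) :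
    MeasurableSet {ω | z ∈ ballUnion x r ω} :=
  measurable_prodMk_right h.measurableSet_mem_ballUnion

variable [IsProbabilityMeasure P] [IsProbabilityMeasure μ]

lemma IsBallModel.measureReal_notMem (h : IsBallModel P γ μ x r)
    (hμ : Integrable (fun r : ℝ => r ^ 2) μ) (z : Plane) :
    P.real {ω | z ∉ ballUnion x r ω} = 1 - coverageProb γ μ := by
  simp_rw [notMem_ballUnion_iff]
  rw [measureReal_def, h.measure_forall_notMem (measurableSet_coveringPairs z)
    (by rw [measure_coveringPairs]; exact meanBallArea_ne_top hμ), measure_coveringPairs,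
    ENNReal.toReal_ofReal (Real.exp_nonneg _), coverageProb]
  ring

lemma IsBallModel.measureReal_mem (h : IsBallModel P γ μ x r)
    (hμ : Integrable (fun r : ℝ => r ^ 2) μ) (z : Plane) :
    P.real {ω | z ∈ ballUnion x r ω} = coverageProb γ μ := by
  have h1 := h.measureReal_notMem hμ z
  have h2 := probReal_compl_eq_one_sub (μ := P) (h.measurableSet_setOf_mem z)
  have h3 : {ω | z ∈ ballUnion x r ω}ᶜ = {ω | z ∉ ballUnion x r ω} := rfl
  rw [h3] at h2
  linarith

/-- If u is covered and v is not, then some grain contains u but not v. This has probability 1 -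
exp(-γ Λ(D)) ≤ γ Λ(D), where D is the set of such centre-radius pairs and Λ the product of area and
`μ`. -/
lemma IsBallModel.measureReal_mem_notMem_le (h : IsBallModel P γ μ x r)
    (hμpos : ∀ᵐ r ∂μ, 0 ≤ r) (hμ : Integrable (fun r : ℝ => r ^ 2) μ) {u v : Plane} {d : ℝ}
    (huv : dist u v ≤ d) :
    P.real {ω | u ∈ ballUnion x r ω ∧ v ∉ ballUnion x r ω} ≤ γ * shiftBound μ d := by
  set D := coveringPairs u \ coveringPairs v with hD
  have hDm : MeasurableSet D := (measurableSet_coveringPairs u).diff (measurableSet_coveringPairs v)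
  have hle : (volume.prod μ) D ≤ ENNReal.ofReal (shiftBound μ d) :=
    measure_coveringPairs_diff_le hμpos hμ huv
  have hfin : (volume.prod μ) D ≠ ∞ := ne_top_of_le_ne_top ENNReal.ofReal_ne_top hle
  have hreal : ((volume.prod μ) D).toReal ≤ shiftBound μ d :=
    ENNReal.toReal_le_of_le_ofReal (shiftBound_nonneg (dist_nonneg.trans huv)) hle
  have hv := h.measure_forall_notMem hDm hfin
  have hsub : {ω | u ∈ ballUnion x r ω ∧ v ∉ ballUnion x r ω} ⊆
      {ω | ∀ i, (x i ω, r i ω) ∉ D}ᶜ := by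
    rintro ω ⟨hu, hv⟩ hω
    rw [notMem_ballUnion_iff] at hv
    exact (notMem_ballUnion_iff.2 fun i hi => hω i ⟨hi, hv i⟩) hu
  have hm : MeasurableSet {ω | ∀ i, (x i ω, r i ω) ∉ D} := by
    have : {ω | ∀ i, (x i ω, r i ω) ∉ D} = ⋂ i, (fun ω => (x i ω, r i ω)) ⁻¹' Dᶜ := by
      ext ω; simp
    rw [this]
    exact .iInter fun i => ((h.centres.measurable i).prodMk (h.radius_measurable i)) hDm.compl
  have h1 : P.real {ω | ∀ i, (x i ω, r i ω) ∉ D} =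
      Real.exp (-(γ * ((volume.prod μ) D).toReal)) := by
    rw [measureReal_def, hv, ENNReal.toReal_ofReal (Real.exp_nonneg _)]
  refine (measureReal_mono hsub).trans ?_
  rw [probReal_compl_eq_one_sub hm, h1]
  have h2 := Real.add_one_le_exp (-(γ * ((volume.prod μ) D).toReal))
  have h3 : (γ : ℝ) * ((volume.prod μ) D).toReal ≤ γ * shiftBound μ d := by gcongr
  linarith

/-! ### The specific area -/

lemma IsBallModel.integral_volume_inter (h : IsBallModel P γ μ x r)
    (hμ : Integrable (fun r : ℝ => r ^ 2) μ) {A : Set Plane} (hA : MeasurableSet A)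
    (hfin : volume A ≠ ∞) :
    ∫ ω, volume.real (ballUnion x r ω ∩ A) ∂P = coverageProb γ μ * volume.real A := by
  have hm := h.measurableSet_mem_ballUnion
  have h0 : ∀ ω, volume (ballUnion x r ω ∩ A) =
      (volume.restrict A) (Prod.mk ω ⁻¹' {q : Ω × Plane | q.2 ∈ ballUnion x r q.1}) := fun ω => by
    rw [Measure.restrict_apply' hA]
    rfl
  have : SFinite (volume.restrict A : Measure Plane) := inferInstance
  have h1 : Measurable fun ω => volume (ballUnion x r ω ∩ A) := by
    simp_rw [h0]
    exact measurable_measure_prodMk_left hm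
  have h2 : ∫⁻ ω, volume (ballUnion x r ω ∩ A) ∂P =
      ENNReal.ofReal (coverageProb γ μ) * volume A := by
    simp_rw [h0]
    rw [← Measure.prod_apply hm, Measure.prod_apply_symm hm]
    have : ∀ z, P ((fun ω => (ω, z)) ⁻¹' {q : Ω × Plane | q.2 ∈ ballUnion x r q.1}) =
        ENNReal.ofReal (coverageProb γ μ) := fun z => by
      rw [← h.measureReal_mem hμ z, measureReal_def, ENNReal.ofReal_toReal (measure_ne_top _ _)]
      rfl
    simp_rw [this]
    simp
  have hp : 0 ≤ coverageProb γ μ := by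
    rw [← h.measureReal_mem hμ 0]
    exact measureReal_nonneg
  simp_rw [measureReal_def]
  rw [integral_toReal h1.aemeasurable (ae_of_all _ fun ω =>
    (measure_mono Set.inter_subset_right).trans_lt hfin.lt_top), h2, ENNReal.toReal_mul,
    ENNReal.toReal_ofReal hp]

/-- The quotient equals the coverage probability for every t > 0, so its limit is that of a
constant. -/
lemma IsBallModel.hasSpecificArea (h : IsBallModel P γ μ x r)
    (hμ : Integrable (fun r : ℝ => r ^ 2) μ) :
    HasSpecificArea P (ballUnion x r) (coverageProb γ μ) := by
  intro K hK _ hKint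
  refine tendsto_const_nhds.congr' ?_
  filter_upwards [eventually_gt_atTop 0] with t ht
  have hc : IsCompact (t • K) := hK.smul t
  have hint : (interior (t • K)).Nonempty := by
    rw [interior_smul₀ ht.ne']
    exact hKint.smul_set
  have hpos : 0 < volume (t • K) := Measure.measure_pos_of_nonempty_interior _ hint
  rw [h.integral_volume_inter hμ hc.measurableSet hc.measure_lt_top.ne, mul_div_cancel_right₀]
  exact (ENNReal.toReal_pos hpos.ne' hc.measure_lt_top.ne).ne'

omit [IsProbabilityMeasure P] in
lemma HasSpecificArea.unique {Ξ : Ω → Set Plane} {v v' : ℝ} (h : HasSpecificArea P Ξ v)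
    (h' : HasSpecificArea P Ξ v') : v = v' := by
  have hint : (interior (Metric.closedBall (0 : Plane) 1)).Nonempty :=
    ⟨0, Metric.ball_subset_interior_closedBall (Metric.mem_ball_self one_pos)⟩
  exact tendsto_nhds_unique
    (h _ (isCompact_closedBall 0 1) (convex_closedBall 0 1) hint)
    (h' _ (isCompact_closedBall 0 1) (convex_closedBall 0 1) hint)

end Coverage

/-! ### Lattice sites in the window -/

lemma finite_sites {a : ℝ} (ha : 0 < a) {W : Set Plane} (hW : IsCompact W) :
    (sites a W).Finite := by
  obtain ⟨R, hR⟩ := hW.isBounded.exists_norm_le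
  set B : Fin 2 → ℤ := fun _ => ⌈R / a⌉ with hB
  refine ((Set.finite_Icc (-B) B).image
    fun m => (WithLp.toLp 2 fun k => a * (m k : ℝ) : Plane)).subset ?_
  rintro z ⟨⟨m, hm⟩, hz⟩
  have hzW : z ∈ W := by simpa using hz 0 fun k => by simp
  have hk : ∀ k, |(m k : ℝ)| ≤ ⌈R / a⌉ := fun k => by
    have h1 : |z k| ≤ R := (PiLp.norm_apply_le z k).trans (hR z hzW)
    rw [hm k, abs_mul, abs_of_pos ha] at h1
    exact ((le_div_iff₀' ha).2 h1).trans (Int.le_ceil _)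
  refine ⟨m, ⟨fun k => ?_, fun k => ?_⟩, ?_⟩
  · exact_mod_cast (abs_le.1 (hk k)).1
  · exact_mod_cast (abs_le.1 (hk k)).2
  · ext k
    simp [hm k]

lemma eventually_nonempty_sites {W : Set Plane} (hW : (interior W).Nonempty) :
    ∀ᶠ a in 𝓝[>] (0 : ℝ), (sites a W).Nonempty := by
  obtain ⟨y, hy⟩ := hW
  obtain ⟨ρ, hρ, hball⟩ := Metric.mem_nhds_iff.1 (mem_interior_iff_mem_nhds.1 hy)
  have h1 : ∀ᶠ a in 𝓝[>] (0 : ℝ), a < ρ / 2 :=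
    nhdsWithin_le_nhds (eventually_lt_nhds (by positivity))
  filter_upwards [h1, self_mem_nhdsWithin] with a haρ ha
  have ha : 0 < a := ha
  -- The interior point y is rounded down to the lattice. Each point of the resulting cell differs
  -- from y by at most a in each coordinate, hence by at most 2a < ρ in distance.
  refine ⟨WithLp.toLp 2 fun k => a * (⌊y k / a⌋ : ℝ), ⟨fun k => ⌊y k / a⌋, fun k => rfl⟩,
    fun c hc => hball ?_⟩
  have hk : ∀ k, |a * (⌊y k / a⌋ : ℝ) + a * c k - y k| ≤ a := fun k => by
    have h2 : a * (⌊y k / a⌋ : ℝ) ≤ y k := (le_div_iff₀' ha).1 (Int.floor_le _)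
    have h3 : y k < a * (⌊y k / a⌋ + 1 : ℝ) := (div_lt_iff₀' ha).1 (Int.lt_floor_add_one _)
    have h4 : 0 ≤ a * c k := mul_nonneg ha.le (hc k).1
    have h5 : a * c k ≤ a := mul_le_of_le_one_right ha.le (hc k).2
    rw [abs_le]
    constructor <;> linarith
  rw [Metric.mem_ball, EuclideanSpace.dist_eq, Fin.sum_univ_two]
  refine lt_of_le_of_lt (Real.sqrt_le_sqrt (y := (2 * a) ^ 2) ?_) ?_
  · have h2 := sq_le_sq' (abs_le.1 (hk 0)).1 (abs_le.1 (hk 0)).2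
    have h3 := sq_le_sq' (abs_le.1 (hk 1)).1 (abs_le.1 (hk 1)).2
    simp only [Real.dist_eq, sq_abs, PiLp.add_apply, PiLp.smul_apply, smul_eq_mul]
    nlinarith
  · rw [Real.sqrt_sq (by positivity)]
    linarith

/-! ### Configurations -/

lemma configIndex_cases {X : Set Plane} {a : ℝ} {z : Plane}
    (h : ¬ ∃ i j, z + a • vertex i ∈ X ∧ z + a • vertex j ∉ X) :
    ((∀ i, z + a • vertex i ∉ X) ∧ configIndex X a z = 0) ∨
      ((∀ i, z + a • vertex i ∈ X) ∧ configIndex X a z = 15) := by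
  by_cases h0 : z + a • vertex 0 ∈ X
  · have hall : ∀ i, z + a • vertex i ∈ X := fun i => by
      by_contra hi
      exact h ⟨0, i, h0, hi⟩
    refine Or.inr ⟨hall, ?_⟩
    simp [configIndex, hall, Fin.sum_univ_four]
  · have hall : ∀ i, z + a • vertex i ∉ X := fun i hi => h ⟨i, 0, hi, h0⟩
    refine Or.inl ⟨hall, ?_⟩
    simp [configIndex, hall]

/-- The class of a cell whose vertices all have the same colour is determined by the colour of its
lower left vertex. -/
lemma configIndex_mem_configClass_iff {X : Set Plane} {a : ℝ} {z : Plane}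
    (h : ¬ ∃ i j, z + a • vertex i ∈ X ∧ z + a • vertex j ∉ X) (j : Fin 6) :
    configIndex X a z ∈ configClass j ↔
      (j = 0 ∧ z + a • vertex 0 ∉ X) ∨ (j = 5 ∧ z + a • vertex 0 ∈ X) := by
  rcases configIndex_cases h with ⟨h1, h2⟩ | ⟨h1, h2⟩
  · rw [h2]
    simp only [h1, not_false_eq_true, and_true, and_false, or_false]
    revert j; decide
  · rw [h2]
    simp only [h1, not_true_eq_false, and_true, and_false, false_or]
    revert j; decide

/-- The limit of the mean frequency of a class of configurations. -/
noncomputable def limitFrequency (p : ℝ) (j : Fin 6) : ℝ :=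
  if j = 0 then 1 - p else if j = 5 then p else 0

lemma sum_mul_limitFrequency (w : Fin 6 → ℝ) (p : ℝ) :
    ∑ j, w j * limitFrequency p j = w 0 * (1 - p) + w 5 * p := by
  simp [Fin.sum_univ_six, limitFrequency]

lemma exists_norm_vertex_sub_le : ∃ C : ℝ, ∀ i j, ‖vertex i - vertex j‖ ≤ C := by
  refine ⟨∑ i, ∑ j, ‖vertex i - vertex j‖, fun i j => ?_⟩
  exact (Finset.single_le_sum (f := fun j => ‖vertex i - vertex j‖) (fun _ _ => norm_nonneg _)
    (Finset.mem_univ j)).trans (Finset.single_le_sum (f := fun i => ∑ j, ‖vertex i - vertex j‖)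
      (fun _ _ => Finset.sum_nonneg fun _ _ => norm_nonneg _) (Finset.mem_univ i))

/-! ### The mean of the estimator -/

section Estimator

variable {Ω : Type u} [MeasurableSpace Ω] {P : Measure Ω} {γ : ℝ≥0} {μ : Measure ℝ}
  {x : ℕ → Ω → Plane} {r : ℕ → Ω → ℝ}

lemma abs_measureReal_sub_le [IsFiniteMeasure P] {A B M : Set Ω}
    (h : ∀ ω ∉ M, ω ∈ A ↔ ω ∈ B) : |P.real A - P.real B| ≤ P.real M := by
  have h1 : P.real A ≤ P.real B + P.real M :=
    (measureReal_mono fun ω hω => by by_cases hM : ω ∈ M <;> simp_all).trans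
      (measureReal_union_le B M)
  have h2 : P.real B ≤ P.real A + P.real M :=
    (measureReal_mono fun ω hω => by by_cases hM : ω ∈ M <;> simp_all).trans
      (measureReal_union_le A M)
  rw [abs_le]
  constructor <;> linarith

lemma IsBallModel.measurable_configIndex (h : IsBallModel P γ μ x r) (a : ℝ) (z : Plane) :
    Measurable fun ω => configIndex (ballUnion x r ω) a z :=
  Finset.measurable_fun_sum _ fun i _ =>
    Measurable.ite (h.measurableSet_setOf_mem (z + a • vertex i)) measurable_const measurable_const

variable [IsProbabilityMeasure P] [IsProbabilityMeasure μ]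

/-- Outside the event M that two vertices differ in colour, the colour of the lower left vertex
decides the class, and its law is known exactly. M is a union over 16 ordered pairs of vertices at
distance at most aC. The bound does not involve z, so it survives averaging over the sites. -/
lemma IsBallModel.abs_configClass_sub_le (h : IsBallModel P γ μ x r)
    (hμpos : ∀ᵐ r ∂μ, 0 ≤ r) (hμ : Integrable (fun r : ℝ => r ^ 2) μ)
    {C : ℝ} (hC : ∀ i j, ‖vertex i - vertex j‖ ≤ C) {a : ℝ} (ha : 0 ≤ a) (z : Plane) (j : Fin 6) :
    |P.real {ω | configIndex (ballUnion x r ω) a z ∈ configClass j} -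
      limitFrequency (coverageProb γ μ) j| ≤ 16 * (γ * shiftBound μ (a * C)) := by
  set M : Set Ω := {ω | ∃ i j, z + a • vertex i ∈ ballUnion x r ω ∧
    z + a • vertex j ∉ ballUnion x r ω} with hM
  have hMle : P.real M ≤ 16 * (γ * shiftBound μ (a * C)) := by
    have h1 : M = ⋃ i, ⋃ j, {ω | z + a • vertex i ∈ ballUnion x r ω ∧
        z + a • vertex j ∉ ballUnion x r ω} := by
      ext ω; simp [hM]
    rw [h1]
    calc _ ≤ ∑ i, ∑ j, P.real {ω | z + a • vertex i ∈ ballUnion x r ω ∧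
          z + a • vertex j ∉ ballUnion x r ω} :=
          (measureReal_iUnion_fintype_le _).trans
            (Finset.sum_le_sum fun i _ => measureReal_iUnion_fintype_le _)
      _ ≤ ∑ _i : Fin 4, ∑ _j : Fin 4, γ * shiftBound μ (a * C) := by
          refine Finset.sum_le_sum fun i _ => Finset.sum_le_sum fun j _ =>
            h.measureReal_mem_notMem_le hμpos hμ ?_
          rw [dist_add_left, dist_eq_norm, ← smul_sub, norm_smul, Real.norm_of_nonneg ha]
          exact mul_le_mul_of_nonneg_left (hC i j) ha
      _ = _ := by
          simp only [Finset.sum_const, Finset.card_univ, Fintype.card_fin, nsmul_eq_mul]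
          push_cast
          ring
  have hlim : limitFrequency (coverageProb γ μ) j =
      P.real {ω | (j = 0 ∧ z + a • vertex 0 ∉ ballUnion x r ω) ∨
        (j = 5 ∧ z + a • vertex 0 ∈ ballUnion x r ω)} := by
    unfold limitFrequency
    split_ifs with h0 h5
    · subst h0
      simp [h.measureReal_notMem hμ]
    · subst h5
      simp [h.measureReal_mem hμ]
    · simp [h0, h5]
  rw [hlim]
  refine (abs_measureReal_sub_le fun ω hω => ?_).trans hMle
  exact configIndex_mem_configClass_iff hω j

omit [IsProbabilityMeasure μ] in
lemma IsBallModel.integral_localEstimator (h : IsBallModel P γ μ x r) {a : ℝ} {W : Set Plane}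
    (hfin : (sites a W).Finite) (w : Fin 6 → ℝ) :
    ∫ ω, localEstimator 2 w a W (ballUnion x r ω) ∂P =
      ∑ j, w j * ((∑ z ∈ hfin.toFinset,
        P.real {ω | configIndex (ballUnion x r ω) a z ∈ configClass j}) /
          ((sites a W).ncard : ℝ)) := by
  classical
  have hm : ∀ z j, MeasurableSet {ω | configIndex (ballUnion x r ω) a z ∈ configClass j} :=
    fun z j => h.measurable_configIndex a z .of_discrete
  have hi : ∀ z j, Integrable
      ({ω | configIndex (ballUnion x r ω) a z ∈ configClass j}.indicator fun _ => (1 : ℝ)) P :=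
    fun z j => (integrable_const 1).indicator (hm z j)
  have hcount : ∀ ω j, (configCount a W (ballUnion x r ω) j : ℝ) = ∑ z ∈ hfin.toFinset,
      {ω | configIndex (ballUnion x r ω) a z ∈ configClass j}.indicator (fun _ => (1 : ℝ)) ω := by
    intro ω j
    have : {z ∈ sites a W | configIndex (ballUnion x r ω) a z ∈ configClass j} =
        ((hfin.toFinset.filter fun z => configIndex (ballUnion x r ω) a z ∈ configClass j :
          Finset Plane) : Set Plane) := by
      ext z; simp
    rw [configCount, this, Set.ncard_coe_finset, Finset.card_filter]
    push_cast
    exact Finset.sum_congr rfl fun z _ => by simp [Set.indicator_apply]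
  simp_rw [localEstimator, hcount]
  simp only [Nat.cast_ofNat, sub_self, zpow_zero, one_mul]
  rw [integral_finsetSum _ fun j _ =>
    ((integrable_finsetSum _ fun z _ => hi z j).div_const _).const_mul _]
  refine Finset.sum_congr rfl fun j _ => ?_
  rw [integral_const_mul, integral_div, integral_finsetSum _ fun z _ => hi z j]
  simp_rw [integral_indicator_const (1 : ℝ) (hm _ j)]
  simp

theorem IsBallModel.tendsto_integral_localEstimator (h : IsBallModel P γ μ x r)
    (hμpos : ∀ᵐ r ∂μ, 0 ≤ r) (hμ : Integrable (fun r : ℝ => r ^ 2) μ)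
    {W : Set Plane} (hW : IsCompact W) (hWint : (interior W).Nonempty) (w : Fin 6 → ℝ) :
    Tendsto (fun a : ℝ => ∫ ω, localEstimator 2 w a W (ballUnion x r ω) ∂P) (𝓝[>] 0)
      (𝓝 (w 0 * (1 - coverageProb γ μ) + w 5 * coverageProb γ μ)) := by
  obtain ⟨C, hC⟩ := exists_norm_vertex_sub_le
  have hδ : Tendsto (fun a : ℝ => 16 * (γ * shiftBound μ (a * C))) (𝓝[>] 0) (𝓝 0) := by
    have h1 : Tendsto (fun a : ℝ => a * C) (𝓝[>] 0) (𝓝 0) := by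
      refine Tendsto.mono_left ?_ nhdsWithin_le_nhds
      simpa using (continuous_mul_const C).tendsto (0 : ℝ)
    simpa using (((tendsto_shiftBound μ).comp h1).const_mul (γ : ℝ)).const_mul 16
  -- A `finsum` is used because `q` is defined for all real a, while finiteness of the sites is
  -- proved only for a > 0.
  set q : ℝ → Fin 6 → ℝ := fun a j => (∑ᶠ z ∈ sites a W,
    P.real {ω | configIndex (ballUnion x r ω) a z ∈ configClass j}) / ((sites a W).ncard : ℝ)
  have hq : ∀ j, Tendsto (fun a => q a j) (𝓝[>] 0) (𝓝 (limitFrequency (coverageProb γ μ) j)) := by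
    intro j
    rw [tendsto_iff_dist_tendsto_zero]
    refine squeeze_zero' (Eventually.of_forall fun _ => dist_nonneg) ?_ hδ
    -- Without sites the quotient would be 0 by the convention for division by zero, so a is taken
    -- small enough for N₀ > 0.
    filter_upwards [eventually_nonempty_sites hWint, self_mem_nhdsWithin] with a hne ha
    have hfin : (sites a W).Finite := finite_sites ha hW
    have hN : 0 < ((sites a W).ncard : ℝ) := by
      exact_mod_cast (Set.ncard_pos hfin).2 hne
    have hcard : ((sites a W).ncard : ℝ) = ∑ z ∈ hfin.toFinset, (1 : ℝ) := by
      simp [Set.ncard_eq_toFinset_card _ hfin]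
    simp only [q]
    rw [finsum_mem_eq_finite_toFinset_sum _ hfin, Real.dist_eq, div_sub' hN.ne', abs_div,
      abs_of_pos hN, div_le_iff₀ hN, hcard, Finset.sum_mul, ← Finset.sum_sub_distrib,
      Finset.mul_sum]
    refine (Finset.abs_sum_le_sum_abs _ _).trans (Finset.sum_le_sum fun z _ => ?_)
    rw [one_mul, mul_one]
    exact h.abs_configClass_sub_le hμpos hμ hC (le_of_lt ha) z j
  rw [← sum_mul_limitFrequency]
  refine (tendsto_finsetSum _ fun j _ => (hq j).const_mul (w j)).congr' ?_
  filter_upwards [self_mem_nhdsWithin] with a ha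
  have hfin : (sites a W).Finite := finite_sites ha hW
  rw [h.integral_localEstimator hfin]
  simp only [q, finsum_mem_eq_finite_toFinset_sum _ hfin]

theorem IsBallModel.isAsymptoticallyUnbiasedArea_iff (h : IsBallModel P γ μ x r)
    (hμpos : ∀ᵐ r ∂μ, 0 ≤ r) (hμ : Integrable (fun r : ℝ => r ^ 2) μ)
    {W : Set Plane} (hW : IsCompact W) (hWint : (interior W).Nonempty) (w : Fin 6 → ℝ) :
    IsAsymptoticallyUnbiasedArea P (ballUnion x r) W w ↔
      w 0 * (1 - coverageProb γ μ) + w 5 * coverageProb γ μ = coverageProb γ μ := by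
  have hlim := h.tendsto_integral_localEstimator hμpos hμ hW hWint w
  constructor
  · rintro ⟨v, hv, hv'⟩
    rw [(h.hasSpecificArea hμ).unique hv]
    conv_rhs => rw [tendsto_nhds_unique hv' hlim]
    rw [(h.hasSpecificArea hμ).unique hv]
  · intro heq
    rw [heq] at hlim
    exact ⟨_, h.hasSpecificArea hμ, hlim⟩

/-- The mean area c is positive and finite, so γ ↦ 1 - exp(-γ c) is injective. -/
lemma coverageProb_ne (hμpos : ∃ ε : ℝ, 0 < ε ∧ ∀ᵐ r ∂μ, ε ≤ r)
    (hμ : Integrable (fun r : ℝ => r ^ 2) μ) {γ γ' : ℝ≥0} (hγ : γ ≠ γ') :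
    coverageProb γ μ ≠ coverageProb γ' μ := by
  have hc : (meanBallArea μ).toReal ≠ 0 :=
    (ENNReal.toReal_pos (meanBallArea_pos hμpos).ne' (meanBallArea_ne_top hμ)).ne'
  simpa [coverageProb, hc] using hγ

end Estimator

/-! ### A criterion for stationary Poisson processes -/

section Criterion

variable {Ω : Type u} [MeasurableSpace Ω] {P : Measure Ω} [IsProbabilityMeasure P]
  {x : ℕ → Ω → Plane} {γ : ℝ≥0}

/-- A point process is a stationary Poisson process if it has the right joint characteristic
functions of the numbers of points in disjoint sets. -/
theorem isStationaryPoisson_of_integral_exp (hx : ∀ i, Measurable (x i))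
    (hfin : ∀ A, MeasurableSet A → volume A < ∞ → ∀ᵐ ω ∂P, pointCount x A ω ≠ ⊤)
    (hchar : ∀ (n : ℕ) (A : Fin n → Set Plane), (∀ k, MeasurableSet (A k)) →
      (∀ k, volume (A k) < ∞) → Pairwise (fun k l => Disjoint (A k) (A l)) → ∀ t : Fin n → ℝ,
      ∫ ω, Complex.exp ((∑ k, (pointCount x (A k) ω).toNat * t k : ℝ) * Complex.I) ∂P =
        ∏ k, Complex.exp ((γ * (volume (A k)).toNNReal : ℝ≥0) *
          (Complex.exp (t k * Complex.I) - 1))) :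
    IsStationaryPoisson P γ x := by
  have hRm : ∀ A, MeasurableSet A → Measurable fun ω => ((pointCount x A ω).toNat : ℝ) :=
    fun A hA => Measurable.comp (g := fun k : ℕ∞ => (k.toNat : ℝ)) .of_discrete
      (measurable_pointCount hx hA)
  have hone : ∀ A, MeasurableSet A → volume A < ∞ → ∀ t : ℝ,
      charFun (P.map fun ω => ((pointCount x A ω).toNat : ℝ)) t =
        Complex.exp ((γ * (volume A).toNNReal : ℝ≥0) * (Complex.exp (t * Complex.I) - 1)) := by
    intro A hA hvol t
    rw [charFun_apply_real, integral_map (hRm A hA).aemeasurable (by fun_prop)]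
    have := hchar 1 (fun _ => A) (fun _ => hA) (fun _ => hvol)
      (fun k l hkl => absurd (Subsingleton.elim k l) hkl) fun _ => t
    simp only [Finset.univ_unique, Finset.sum_singleton, Finset.prod_singleton] at this
    rw [← this]
    refine integral_congr_ae (ae_of_all _ fun ω => ?_)
    simp only
    push_cast
    ring_nf
  refine ⟨hx, fun A hA hvol k => ?_, fun n A hA hvol hdisj => ?_⟩
  -- Counts are made real so that characteristic functions determine their laws. `toNat` sends `⊤`
  -- to 0, which is harmless because `⊤` has probability zero.
  · have hmap : P.map (fun ω => ((pointCount x A ω).toNat : ℝ)) =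
        (poissonMeasure (γ * (volume A).toNNReal)).map (fun n : ℕ => (n : ℝ)) := by
      have := Measure.isProbabilityMeasure_map (μ := P) (hRm A hA).aemeasurable
      refine Measure.ext_of_charFun (funext fun t => ?_)
      rw [hone A hA hvol, charFun_map_cast_poissonMeasure]
    have h1 : P {ω | pointCount x A ω = k} =
        P ((fun ω => ((pointCount x A ω).toNat : ℝ)) ⁻¹' {(k : ℝ)}) := by
      refine measure_congr ?_
      filter_upwards [hfin A hA hvol] with ω hω
      refine propext ?_
      change pointCount x A ω = k ↔ ((pointCount x A ω).toNat : ℝ) = k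
      lift pointCount x A ω to ℕ using hω with j
      simp
    rw [h1, ← Measure.map_apply (hRm A hA) (measurableSet_singleton _), hmap,
      Measure.map_apply (by fun_prop) (measurableSet_singleton _)]
    congr 1
    ext j
    simp
  · have hind : iIndepFun (fun k ω => ((pointCount x (A k) ω).toNat : ℝ)) P := by
      rw [iIndepFun_iff_charFun_pi fun k => (hRm _ (hA k)).aemeasurable]
      intro t
      rw [Finset.prod_congr rfl fun k _ => hone _ (hA k) (hvol k) (t k),
        ← hchar n A hA hvol hdisj fun k => t k, charFun_apply, integral_map]
      · refine integral_congr_ae (ae_of_all _ fun ω => ?_)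
        simp only [PiLp.inner_apply, Real.inner_apply]
      · exact Measurable.aemeasurable ((WithLp.measurable_toLp 2 _).comp
          (measurable_pi_lambda _ fun k => hRm _ (hA k)))
      · fun_prop
    -- The floor recovers the original count from its real version almost surely.
    refine (hind.comp (fun _ s => ((⌊s⌋₊ : ℕ) : ℕ∞)) fun _ =>
      Measurable.comp .of_discrete Nat.measurable_floor).congr fun k => ?_
    filter_upwards [hfin _ (hA k) (hvol k)] with ω hω
    simp only [Function.comp_apply, Nat.floor_natCast]
    exact ENat.natCast_toNat hω

end Criterion

/-! ### Enumeration of the points of a cellwise construction -/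

/-- The codes of the pairs `(n, k)` with `k < N n`. -/
def usedCodes (N : ℕ → ℕ) : Set ℕ := {m | m.unpair.2 < N m.unpair.1}

/-- The `j`-th element of `usedCodes N`. -/
noncomputable def usedCode (N : ℕ → ℕ) (j : ℕ) : ℕ := Nat.nth (· ∈ usedCodes N) j

/-- The number of indices `k < N` with `U k ∈ A`. -/
noncomputable def cellCount {E : Type*} (N : ℕ) (U : ℕ → E) (A : Set E) : ℕ :=
  open Classical in ((Finset.range N).filter fun k => U k ∈ A).card

lemma infinite_usedCodes {N : ℕ → ℕ} (h : ∃ᶠ n in atTop, N n ≠ 0) : (usedCodes N).Infinite := by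
  rw [Nat.frequently_atTop_iff_infinite] at h
  refine (h.image (f := fun n => Nat.pair n 0) fun a _ b _ hab => ?_).mono ?_
  · exact (Nat.pair_eq_pair.1 hab).1
  · rintro _ ⟨n, hn, rfl⟩
    simpa [usedCodes] using Nat.pos_of_ne_zero hn

/-- The enumeration is a bijection from ℕ onto the used pairs. Infiniteness is essential, since
`Nat.nth` returns 0 once a finite set is exhausted. -/
lemma encard_usedCode_preimage {E : Type*} {N : ℕ → ℕ} (h : (usedCodes N).Infinite)
    (U : ℕ × ℕ → E) (A : Set E) :
    {j | U (usedCode N j).unpair ∈ A}.encard =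
      {q : Σ _ : ℕ, ℕ | q.2 < N q.1 ∧ U (q.1, q.2) ∈ A}.encard := by
  have hinj : Function.Injective fun j =>
      (⟨(usedCode N j).unpair.1, (usedCode N j).unpair.2⟩ : Σ _ : ℕ, ℕ) := by
    intro i j hij
    simp only [Sigma.mk.injEq, heq_eq_eq] at hij
    have : (usedCode N i).unpair = (usedCode N j).unpair := Prod.ext hij.1 hij.2
    have hcode : usedCode N i = usedCode N j := by
      rw [← Nat.pair_unpair (usedCode N i), this, Nat.pair_unpair]
    exact Nat.nth_injective (p := (· ∈ usedCodes N)) h hcode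
  rw [← hinj.encard_image]
  congr 1
  ext ⟨n, k⟩
  constructor
  · rintro ⟨j, hj, hq⟩
    simp only [Sigma.mk.injEq, heq_eq_eq] at hq
    obtain ⟨rfl, rfl⟩ := hq
    exact ⟨Nat.nth_mem_of_infinite h j, hj⟩
  · rintro ⟨hk, hA⟩
    have hmem : Nat.pair n k ∈ usedCodes N := by simpa [usedCodes] using hk
    obtain ⟨j, hj⟩ : Nat.pair n k ∈ Set.range (Nat.nth (· ∈ usedCodes N)) := by
      rw [Nat.range_nth_of_infinite (p := (· ∈ usedCodes N)) h]
      exact hmem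
    have hj' : usedCode N j = Nat.pair n k := hj
    refine ⟨j, ?_, ?_⟩
    · simpa [hj'] using hA
    · simp [hj']

lemma eventually_encard_eq_sum_cellCount {E : Type*} {N : ℕ → ℕ} {U : ℕ × ℕ → E} {A : Set E}
    (h : ∀ᶠ n in atTop, cellCount (N n) (fun k => U (n, k)) A = 0) :
    ∀ᶠ K in atTop, {q : Σ _ : ℕ, ℕ | q.2 < N q.1 ∧ U (q.1, q.2) ∈ A}.encard =
      ((∑ n ∈ Finset.range K, cellCount (N n) (fun k => U (n, k)) A : ℕ) : ℕ∞) := by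
  classical
  obtain ⟨K₀, hK₀⟩ := eventually_atTop.1 h
  filter_upwards [eventually_ge_atTop K₀] with K hK
  have : {q : Σ _ : ℕ, ℕ | q.2 < N q.1 ∧ U (q.1, q.2) ∈ A} =
      (((Finset.range K).sigma fun n => (Finset.range (N n)).filter fun k => U (n, k) ∈ A :
        Finset (Σ _ : ℕ, ℕ)) : Set (Σ _ : ℕ, ℕ)) := by
    ext ⟨n, k⟩
    simp only [Set.mem_ofPred_eq, Finset.coe_sigma, Set.mem_sigma_iff, Finset.mem_coe,
      Finset.mem_range, Finset.mem_filter, iff_and_self]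
    rintro ⟨hk, hA⟩
    by_contra hn
    have := hK₀ n (hK.trans (not_lt.1 hn))
    rw [cellCount, Finset.card_eq_zero, Finset.filter_eq_empty_iff] at this
    exact this (Finset.mem_range.2 hk) hA
  rw [this, Set.encard_coe_eq_coe_finsetCard, Finset.card_sigma]
  simp only [cellCount]

/-- This form makes measurability in `N` visible, because `Nat.count` is a finite sum of indicators.
The second alternative is the default value 0 of `Nat.nth`. -/
lemma usedCode_eq_iff (N : ℕ → ℕ) (j m : ℕ) [DecidablePred (· ∈ usedCodes N)] :
    usedCode N j = m ↔ (m ∈ usedCodes N ∧ Nat.count (· ∈ usedCodes N) m = j) ∨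
      (m = 0 ∧ ¬ ∃ m', m' ∈ usedCodes N ∧ Nat.count (· ∈ usedCodes N) m' = j) := by
  have hcount : ∀ m', m' ∈ usedCodes N → Nat.count (· ∈ usedCodes N) m' = j →
      usedCode N j = m' := fun m' hm' hc => by
    rw [usedCode, ← hc, Nat.nth_count hm']
  by_cases h : ∃ m', m' ∈ usedCodes N ∧ Nat.count (· ∈ usedCodes N) m' = j
  · simp only [h, not_true_eq_false, and_false, or_false]
    obtain ⟨m', hm', hc⟩ := h
    refine ⟨fun hm => ?_, fun hm => hcount m hm.1 hm.2⟩
    rw [hcount m' hm' hc] at hm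
    exact hm ▸ ⟨hm', hc⟩
  · have h0 : usedCode N j = 0 := by
      by_contra h0
      refine h ⟨usedCode N j, ?_, ?_⟩
      · exact Nat.nth_mem j fun hf => by
          by_contra hj
          exact h0 (Nat.nth_of_card_le hf (not_lt.1 hj))
      · exact Nat.count_nth fun hf => by
          by_contra hj
          exact h0 (Nat.nth_of_card_le hf (not_lt.1 hj))
    rw [h0]
    constructor
    · rintro rfl
      exact Or.inr ⟨rfl, h⟩
    · rintro (hm | hm)
      · exact absurd ⟨m, hm⟩ h
      · exact hm.1.symm

lemma measurable_usedCode {Ω : Type*} [MeasurableSpace Ω] {N : ℕ → Ω → ℕ}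
    (hN : ∀ n, Measurable (N n)) (j : ℕ) : Measurable fun ω => usedCode (fun n => N n ω) j := by
  classical
  have hmem : ∀ m, MeasurableSet {ω | m ∈ usedCodes fun n => N n ω} := fun m =>
    measurableSet_lt measurable_const (hN _)
  have hcount : ∀ m, Measurable fun ω => Nat.count (· ∈ usedCodes fun n => N n ω) m := by
    intro m
    simp_rw [Nat.count_eq_card_filter_range, Finset.card_filter]
    exact Finset.measurable_fun_sum _ fun i _ =>
      Measurable.ite (hmem i) measurable_const measurable_const
  have hboth : ∀ m, MeasurableSet {ω | (m ∈ usedCodes fun n => N n ω) ∧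
      Nat.count (· ∈ usedCodes fun n => N n ω) m = j} := fun m =>
    (hmem m).inter (hcount m (measurableSet_singleton j))
  refine measurable_to_countable' fun m => ?_
  have : (fun ω => usedCode (fun n => N n ω) j) ⁻¹' {m} =
      {ω | (m ∈ usedCodes fun n => N n ω) ∧ Nat.count (· ∈ usedCodes fun n => N n ω) m = j} ∪
        ({ω | m = 0} ∩ (⋃ m', {ω | (m' ∈ usedCodes fun n => N n ω) ∧
          Nat.count (· ∈ usedCodes fun n => N n ω) m' = j})ᶜ) := by
    ext ω
    simp only [Set.mem_preimage, Set.mem_singleton_iff, Set.mem_union, Set.mem_inter_iff,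
      Set.mem_compl_iff, Set.mem_iUnion, Set.mem_ofPred_eq]
    exact usedCode_eq_iff _ j m
  rw [this]
  exact (hboth m).union ((MeasurableSet.const _).inter (MeasurableSet.iUnion hboth).compl)

/-! ### Construction of a stationary Poisson process -/

/-- Turns the pieces of an s-finite decomposition of the area into laws for single points; for the
zero measure any law will do. -/
lemma exists_eq_smul_isProbabilityMeasure {E : Type*} [MeasurableSpace E] [Nonempty E]
    (ν : Measure E) [IsFiniteMeasure ν] :
    ∃ ρ : Measure E, IsProbabilityMeasure ρ ∧ ν = ν Set.univ • ρ := by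
  by_cases h : ν = 0
  · exact ⟨Measure.dirac (Classical.arbitrary E), inferInstance, by simp [h]⟩
  · have h0 : ν Set.univ ≠ 0 := by simpa using h
    refine ⟨(ν Set.univ)⁻¹ • ν, ⟨?_⟩, ?_⟩
    · simp [ENNReal.inv_mul_cancel h0 (measure_ne_top _ _)]
    · rw [smul_smul, ENNReal.mul_inv_cancel h0 (measure_ne_top _ _), one_smul]

/-- Independent Poisson numbers `N n` with means `l n`, and, on another probability space,
independent points `U (n, k)` with laws `ρ n`, where `∑ n, l n • ρ n` is `γ` times the area. -/
structure IsCellModel {Ω₁ Ω₂ : Type u} [MeasurableSpace Ω₁] [MeasurableSpace Ω₂]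
    (P₁ : Measure Ω₁) (P₂ : Measure Ω₂) (γ : ℝ≥0) (l : ℕ → ℝ≥0) (ρ : ℕ → Measure Plane)
    (N : ℕ → Ω₁ → ℕ) (U : ℕ × ℕ → Ω₂ → Plane) : Prop where
  number_measurable : ∀ n, Measurable (N n)
  number_law : ∀ n, P₁.map (N n) = poissonMeasure (l n)
  number_indep : iIndepFun N P₁
  point_measurable : ∀ q, Measurable (U q)
  point_law : ∀ q : ℕ × ℕ, P₂.map (U q) = ρ q.1
  point_indep : iIndepFun U P₂
  intensity : ∀ A, MeasurableSet A → ∑' n, (l n : ℝ≥0∞) * ρ n A = γ * volume A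

/-- The points of a cell model, enumerated as a sequence. -/
noncomputable def cellPoint {Ω₁ Ω₂ : Type u} (N : ℕ → Ω₁ → ℕ) (U : ℕ × ℕ → Ω₂ → Plane) (j : ℕ)
    (ω : Ω₁ × Ω₂) : Plane :=
  U (usedCode (fun n => N n ω.1) j).unpair ω.2

section CellModel

variable {Ω₁ Ω₂ : Type u} [MeasurableSpace Ω₁] [MeasurableSpace Ω₂] {P₁ : Measure Ω₁}
  {P₂ : Measure Ω₂} [IsProbabilityMeasure P₁] [IsProbabilityMeasure P₂] {γ : ℝ≥0} {l : ℕ → ℝ≥0}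
  {ρ : ℕ → Measure Plane} [∀ n, IsProbabilityMeasure (ρ n)] {N : ℕ → Ω₁ → ℕ}
  {U : ℕ × ℕ → Ω₂ → Plane}

omit [IsProbabilityMeasure P₁] [IsProbabilityMeasure P₂] [∀ n, IsProbabilityMeasure (ρ n)] in
lemma IsCellModel.measurable_cellPoint (h : IsCellModel P₁ P₂ γ l ρ N U) (j : ℕ) :
    Measurable (cellPoint N U j) := by
  have h1 : Measurable fun q : ℕ × Ω₂ => U q.1.unpair q.2 :=
    measurable_from_prod_countable_right fun m => h.point_measurable m.unpair
  exact h1.comp (((measurable_usedCode h.number_measurable j).comp measurable_fst).prodMk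
    measurable_snd)

omit [IsProbabilityMeasure P₁] [IsProbabilityMeasure P₂] [∀ n, IsProbabilityMeasure (ρ n)] in
lemma IsCellModel.measurable_prod_cells (h : IsCellModel P₁ P₂ γ l ρ N U) {g : Plane → ℂ}
    (hg : Measurable g) (s : Finset ℕ) : Measurable fun ω : Ω₁ × Ω₂ =>
      ∏ n ∈ s, ∏ k ∈ Finset.range (N n ω.1), g (U (n, k) ω.2) := by
  refine Finset.measurable_fun_prod _ fun n _ => ?_
  have h1 : Measurable fun q : ℕ × Ω₂ => ∏ k ∈ Finset.range q.1, g (U (n, k) q.2) :=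
    measurable_from_prod_countable_right fun m =>
      Finset.measurable_fun_prod (Finset.range m) fun k _ => hg.comp (h.point_measurable (n, k))
  exact h1.comp (((h.number_measurable n).comp measurable_fst).prodMk measurable_snd)

omit [IsProbabilityMeasure P₁] [∀ n, IsProbabilityMeasure (ρ n)] [IsProbabilityMeasure P₂] in
lemma IsCellModel.integral_prod_points (h : IsCellModel P₁ P₂ γ l ρ N U) {g : Plane → ℂ}
    (hg : Measurable g) (s : Finset ℕ) (m : ℕ → ℕ) :
    ∫ ω, ∏ n ∈ s, ∏ k ∈ Finset.range (m n), g (U (n, k) ω) ∂P₂ =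
      ∏ n ∈ s, (∫ y, g y ∂(ρ n)) ^ m n := by
  set T : Finset (Σ _ : ℕ, ℕ) := s.sigma fun n => Finset.range (m n)
  have hinj : Function.Injective fun q : T => ((q : Σ _ : ℕ, ℕ).1, (q : Σ _ : ℕ, ℕ).2) := by
    rintro ⟨⟨a, b⟩, hp⟩ ⟨⟨a', b'⟩, hq⟩ hab
    obtain ⟨rfl, rfl⟩ : a = a' ∧ b = b' := Prod.ext_iff.1 hab
    rfl
  have hint : ∀ q, ∫ ω, g (U q ω) ∂P₂ = ∫ y, g y ∂(ρ q.1) := fun q => by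
    rw [← h.point_law q, integral_map (h.point_measurable q).aemeasurable
      hg.aestronglyMeasurable]
  calc ∫ ω, ∏ n ∈ s, ∏ k ∈ Finset.range (m n), g (U (n, k) ω) ∂P₂
      = ∫ ω, ∏ q : T, g (U ((q : Σ _ : ℕ, ℕ).1, (q : Σ _ : ℕ, ℕ).2) ω) ∂P₂ := by
        congr with ω
        rw [Finset.prod_sigma' s _ fun n k => g (U (n, k) ω), ← Finset.prod_coe_sort]
    _ = ∏ q : T, ∫ ω, g (U ((q : Σ _ : ℕ, ℕ).1, (q : Σ _ : ℕ, ℕ).2) ω) ∂P₂ :=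
        (h.point_indep.precomp hinj).integral_fun_prod_comp (f := fun _ => g)
          (fun q => (h.point_measurable _).aemeasurable) fun q => hg.aestronglyMeasurable
    _ = ∏ q : T, ∫ y, g y ∂(ρ (q : Σ _ : ℕ, ℕ).1) := Finset.prod_congr rfl fun q _ => hint _
    _ = ∏ n ∈ s, (∫ y, g y ∂(ρ n)) ^ m n := by
        rw [Finset.prod_coe_sort T fun q => ∫ y, g y ∂(ρ q.1), Finset.prod_sigma]
        simp

omit [∀ n, IsProbabilityMeasure (ρ n)] in
/-- The generating functional of finitely many cells. -/
lemma IsCellModel.integral_prod_cells (h : IsCellModel P₁ P₂ γ l ρ N U)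
    {g : Plane → ℂ} (hg : Measurable g) (hg1 : ∀ y, ‖g y‖ ≤ 1) (s : Finset ℕ) :
    ∫ ω, ∏ n ∈ s, ∏ k ∈ Finset.range (N n ω.1), g (U (n, k) ω.2) ∂(P₁.prod P₂) =
      ∏ n ∈ s, Complex.exp (l n * (∫ y, g y ∂(ρ n) - 1)) := by
  have hm := h.measurable_prod_cells hg s
  have hi : Integrable (fun ω : Ω₁ × Ω₂ =>
      ∏ n ∈ s, ∏ k ∈ Finset.range (N n ω.1), g (U (n, k) ω.2)) (P₁.prod P₂) := by
    refine Integrable.of_bound hm.aestronglyMeasurable 1 (ae_of_all _ fun ω => ?_)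
    rw [norm_prod]
    refine Finset.prod_le_one (fun _ _ => norm_nonneg _) fun n _ => ?_
    rw [norm_prod]
    exact Finset.prod_le_one (fun _ _ => norm_nonneg _) fun k _ => hg1 _
  -- With the numbers fixed, independence of the points gives powers of ∫ g dρₙ. Averaging over the
  -- numbers evaluates the Poisson generating function at these integrals.
  rw [integral_prod _ hi]
  simp_rw [h.integral_prod_points hg s fun n => N n _]
  have hpow : ∀ n, ∫ ω, (∫ y, g y ∂(ρ n)) ^ N n ω ∂P₁ =
      Complex.exp (l n * (∫ y, g y ∂(ρ n) - 1)) := fun n => by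
    rw [← integral_pow_poissonMeasure, ← h.number_law n,
      integral_map (h.number_measurable n).aemeasurable (by fun_prop)]
  calc ∫ ω, ∏ n ∈ s, (∫ y, g y ∂(ρ n)) ^ N n ω ∂P₁
      = ∫ ω, ∏ n : s, (∫ y, g y ∂(ρ n)) ^ N n ω ∂P₁ := by
        congr with ω
        rw [Finset.prod_coe_sort s fun n => (∫ y, g y ∂(ρ n)) ^ N n ω]
    _ = ∏ n : s, ∫ ω, (∫ y, g y ∂(ρ n)) ^ N n ω ∂P₁ :=
        (h.number_indep.precomp Subtype.val_injective).integral_fun_prod_comp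
          (f := fun (n : s) (k : ℕ) => (∫ y, g y ∂(ρ n)) ^ k)
          (fun n => (h.number_measurable _).aemeasurable) fun n => by fun_prop
    _ = _ := by
        rw [Finset.prod_congr rfl fun (n : s) _ => hpow n,
          Finset.prod_coe_sort s fun n => Complex.exp (l n * (∫ y, g y ∂(ρ n) - 1))]

omit [IsProbabilityMeasure P₁] [IsProbabilityMeasure P₂] in
-- The means sum to γ times the area of the plane, which is infinite, so the product of the
-- probabilities exp(-lₙ) over any tail of cells vanishes. Hence there are almost surely infinitely
-- many points to enumerate.
lemma IsCellModel.ae_frequently_number_ne_zero (h : IsCellModel P₁ P₂ γ l ρ N U) (hγ : 0 < γ) :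
    ∀ᵐ ω ∂P₁, ∃ᶠ n in atTop, N n ω ≠ 0 := by
  have hl : ¬ Summable fun n => (l n : ℝ) := fun hs => by
    have h1 := h.intensity Set.univ .univ
    simp only [measure_univ, mul_one] at h1
    have h2 : (volume : Measure Plane) Set.univ = ∞ := measure_univ_of_isAddLeftInvariant _
    rw [h2, ENNReal.mul_top (by simpa using hγ.ne')] at h1
    exact ENNReal.tsum_coe_ne_top_iff_summable.2 (NNReal.summable_coe.1 hs) h1
  have htop := (not_summable_iff_tendsto_nat_atTop_of_nonneg fun n => (l n).coe_nonneg).1 hl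
  have hzero : ∀ n, P₁ (N n ⁻¹' {0}) = ENNReal.ofReal (Real.exp (-l n)) := fun n => by
    rw [← Measure.map_apply (h.number_measurable n) (measurableSet_singleton _), h.number_law n,
      poissonMeasure_singleton]
    simp
  have hnull : ∀ a, P₁ {ω | ∀ n ≥ a, N n ω = 0} = 0 := by
    intro a
    have hle : ∀ b, P₁ {ω | ∀ n ≥ a, N n ω = 0} ≤
        ENNReal.ofReal (Real.exp (-(∑ n ∈ Finset.range b, (l n : ℝ)) +
          ∑ n ∈ Finset.range a, (l n : ℝ))) := by
      intro b
      have h1 : {ω | ∀ n ≥ a, N n ω = 0} ⊆ ⋂ n ∈ Finset.range b \ Finset.range a, N n ⁻¹' {0} :=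
        fun ω hω => by
          simp only [Set.mem_iInter]
          intro n hn
          simp only [Finset.mem_sdiff, Finset.mem_range, not_lt] at hn
          exact hω n hn.2
      refine (measure_mono h1).trans ?_
      rw [h.number_indep.measure_inter_preimage_eq_mul _ fun n _ => measurableSet_singleton 0,
        Finset.prod_congr rfl fun n _ => hzero n,
        ← ENNReal.ofReal_prod_of_nonneg fun _ _ => Real.exp_nonneg _, ← Real.exp_sum]
      refine ENNReal.ofReal_le_ofReal (Real.exp_le_exp.2 ?_)
      rw [Finset.sum_neg_distrib]
      have h2 : ∑ n ∈ Finset.range b, (l n : ℝ) ≤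
          ∑ n ∈ Finset.range b \ Finset.range a ∪ Finset.range a, (l n : ℝ) := by
        refine Finset.sum_le_sum_of_subset_of_nonneg (fun n hn => ?_) fun _ _ _ => (l _).coe_nonneg
        rw [Finset.sdiff_union_self_eq_union]
        exact Finset.mem_union_left _ hn
      rw [Finset.sum_union Finset.sdiff_disjoint] at h2
      linarith
    have h3 := ENNReal.tendsto_ofReal (Real.tendsto_exp_atBot.comp
      (tendsto_atBot_add_const_right _ (∑ n ∈ Finset.range a, (l n : ℝ))
        (tendsto_neg_atTop_atBot.comp htop)))
    rw [ENNReal.ofReal_zero] at h3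
    exact le_antisymm (ge_of_tendsto' h3 hle) zero_le
  have hall : ∀ᵐ ω ∂P₁, ∀ a, ¬ ∀ n ≥ a, N n ω = 0 := ae_all_iff.2 fun a => by
    rw [ae_iff]
    simpa using hnull a
  filter_upwards [hall] with ω hω
  rw [frequently_atTop]
  intro a
  simpa using hω a

/-- Borel–Cantelli: cell n puts a point in A with probability 1 - exp(-lₙ ρₙ(A)) ≤ lₙ ρₙ(A), and
these bounds sum to γ times the area of A. The void probability is the generating functional at the
indicator of the complement of A. -/
lemma IsCellModel.ae_eventually_cellCount_eq_zero (h : IsCellModel P₁ P₂ γ l ρ N U)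
    {A : Set Plane} (hA : MeasurableSet A) (hvol : volume A < ∞) :
    ∀ᵐ ω ∂(P₁.prod P₂), ∀ᶠ n in atTop,
      cellCount (N n ω.1) (fun k => U (n, k) ω.2) A = 0 := by
  classical
  set g : Plane → ℂ := Aᶜ.indicator fun _ => 1 with hgdef
  have hg : Measurable g := measurable_const.indicator hA.compl
  have hg1 : ∀ y, ‖g y‖ ≤ 1 := fun y => by
    rw [hgdef, Set.indicator_apply]; split_ifs <;> simp
  set Z : ℕ → Set (Ω₁ × Ω₂) := fun n => {ω | cellCount (N n ω.1) (fun k => U (n, k) ω.2) A = 0}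
    with hZ
  have hprod : ∀ n ω, ∏ k ∈ Finset.range (N n ω.1), g (U (n, k) ω.2) =
      (Z n).indicator (fun _ => (1 : ℂ)) ω := by
    intro n ω
    by_cases hω : ω ∈ Z n
    · rw [Set.indicator_of_mem hω]
      refine Finset.prod_eq_one fun k hk => ?_
      have : U (n, k) ω.2 ∉ A := by
        simp only [hZ, cellCount, Set.mem_ofPred_eq, Finset.card_eq_zero,
          Finset.filter_eq_empty_iff] at hω
        exact hω hk
      simp [hgdef, this]
    · rw [Set.indicator_of_notMem hω]
      simp only [hZ, cellCount, Set.mem_ofPred_eq, Finset.card_eq_zero,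
        Finset.filter_eq_empty_iff, not_forall, not_not] at hω
      obtain ⟨k, hk, hkA⟩ := hω
      exact Finset.prod_eq_zero hk (by simp [hgdef, hkA])
  have hZm : ∀ n, MeasurableSet (Z n) := by
    intro n
    have h1 : Measurable fun q : ℕ × Ω₂ => cellCount q.1 (fun k => U (n, k) q.2) A := by
      refine measurable_from_prod_countable_right fun m => ?_
      simp_rw [cellCount, Finset.card_filter]
      exact Finset.measurable_fun_sum _ fun k _ =>
        Measurable.ite (h.point_measurable _ hA) measurable_const measurable_const
    exact (h1.comp (((h.number_measurable n).comp measurable_fst).prodMk measurable_snd))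
      (measurableSet_singleton 0)
  have hgint : ∀ n, ∫ y, g y ∂(ρ n) = ((1 - (ρ n).real A : ℝ) : ℂ) := fun n => by
    rw [hgdef, integral_indicator_const (1 : ℂ) hA.compl, probReal_compl_eq_one_sub hA,
      Complex.real_smul, mul_one]
  have hPZ : ∀ n, (P₁.prod P₂).real (Z n) = Real.exp (-(l n * (ρ n).real A)) := by
    intro n
    have h1 := h.integral_prod_cells hg hg1 {n}
    simp only [Finset.prod_singleton, hprod] at h1
    rw [integral_indicator_const (1 : ℂ) (hZm n), hgint, Complex.real_smul, mul_one] at h1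
    apply Complex.ofReal_injective
    rw [h1]
    push_cast
    ring_nf
  have hle : ∀ n, (P₁.prod P₂) (Z n)ᶜ ≤ l n * ρ n A := by
    intro n
    rw [← ENNReal.ofReal_toReal (measure_ne_top (P₁.prod P₂) (Z n)ᶜ), ← measureReal_def,
      probReal_compl_eq_one_sub (hZm n), hPZ]
    have h2 := Real.add_one_le_exp (-(l n * (ρ n).real A))
    refine (ENNReal.ofReal_le_ofReal (q := l n * (ρ n).real A) (by linarith)).trans ?_
    rw [ENNReal.ofReal_mul (l n).coe_nonneg, measureReal_def,
      ENNReal.ofReal_toReal (measure_ne_top _ _), ENNReal.ofReal_coe_nnreal]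
  have hsum : ∑' n, (P₁.prod P₂) (Z n)ᶜ ≠ ∞ := by
    refine ne_top_of_le_ne_top ?_ (ENNReal.tsum_le_tsum hle)
    rw [h.intensity A hA]
    exact ENNReal.mul_ne_top ENNReal.coe_ne_top hvol.ne
  filter_upwards [ae_eventually_notMem hsum] with ω hω
  filter_upwards [hω] with n hn
  exact not_not.1 hn

lemma IsCellModel.ae_eventually_pointCount_eq (h : IsCellModel P₁ P₂ γ l ρ N U) (hγ : 0 < γ)
    {A : Set Plane} (hA : MeasurableSet A) (hvol : volume A < ∞) :
    ∀ᵐ ω ∂(P₁.prod P₂), ∀ᶠ K in atTop, pointCount (cellPoint N U) A ω =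
      ((∑ n ∈ Finset.range K, cellCount (N n ω.1) (fun k => U (n, k) ω.2) A : ℕ) : ℕ∞) := by
  have h1 : ∀ᵐ ω ∂(P₁.prod P₂), ∃ᶠ n in atTop, N n ω.1 ≠ 0 :=
    Measure.quasiMeasurePreserving_fst.ae (h.ae_frequently_number_ne_zero hγ)
  filter_upwards [h1, h.ae_eventually_cellCount_eq_zero hA hvol] with ω hω hω'
  filter_upwards [eventually_encard_eq_sum_cellCount (N := fun n => N n ω.1)
    (U := fun q => U q ω.2) hω'] with K hK
  rw [← hK, ← encard_usedCode_preimage (infinite_usedCodes hω) (fun q => U q ω.2) A]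
  rfl

/-- With g = exp(i ∑ tₖ 1_{Aₖ}), the product of g over the points of the first K cells is the
exponential whose mean is the joint characteristic function of their counts. That mean is an
explicit exponential, and its exponent converges by `intensity`. On the other side the counts are
eventually constant in K almost surely, and dominated convergence applies. -/
theorem IsCellModel.isStationaryPoisson (h : IsCellModel P₁ P₂ γ l ρ N U) (hγ : 0 < γ) :
    IsStationaryPoisson (P₁.prod P₂) γ (cellPoint N U) := by
  classical
  refine isStationaryPoisson_of_integral_exp h.measurable_cellPoint (fun A hA hvol => ?_)
    fun n A hA hvol hdisj t => ?_
  · filter_upwards [h.ae_eventually_pointCount_eq hγ hA hvol] with ω hω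
    obtain ⟨K, hK⟩ := hω.exists
    rw [hK]
    exact ENat.natCast_ne_top _
  set f : Plane → ℝ := fun y => ∑ k, (A k).indicator (fun _ => t k) y with hf
  set g : Plane → ℂ := fun y => Complex.exp (f y * Complex.I) with hgdef
  have hfm : Measurable f :=
    Finset.measurable_fun_sum _ fun k _ => measurable_const.indicator (hA k)
  have hg : Measurable g := by fun_prop
  have hg1 : ∀ y, ‖g y‖ ≤ 1 := fun y => (Complex.norm_exp_ofReal_mul_I _).le
  -- Disjointness of the Aₖ linearises the exponential: at most one indicator is nonzero at y.
  have hgsum : ∀ y, g y = 1 + ∑ k, (A k).indicator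
      (fun _ => Complex.exp (t k * Complex.I) - 1) y := by
    intro y
    by_cases hy : ∃ k, y ∈ A k
    · obtain ⟨k, hk⟩ := hy
      have hne : ∀ j, j ≠ k → y ∉ A j := fun j hj hyj =>
        Set.disjoint_left.1 (hdisj hj) hyj hk
      rw [hgdef]
      simp only [hf]
      rw [Finset.sum_eq_single k (fun j _ hj => Set.indicator_of_notMem (hne j hj) _) (by simp),
        Finset.sum_eq_single k (fun j _ hj => Set.indicator_of_notMem (hne j hj) _) (by simp),
        Set.indicator_of_mem hk, Set.indicator_of_mem hk]
      ring
    · rw [not_exists] at hy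
      simp [hgdef, hf, hy]
  have hgint : ∀ j, ∫ y, g y ∂(ρ j) - 1 =
      ∑ k, ((ρ j).real (A k) : ℂ) * (Complex.exp (t k * Complex.I) - 1) := by
    intro j
    simp_rw [hgsum]
    rw [integral_add (integrable_const _) (integrable_finsetSum _ fun k _ =>
      (integrable_const _).indicator (hA k)), integral_finsetSum _ fun k _ =>
      (integrable_const _).indicator (hA k)]
    simp_rw [integral_indicator_const _ (hA _), Complex.real_smul]
    simp
  have hcell : ∀ K (ω : Ω₁ × Ω₂), ∏ j ∈ Finset.range K, ∏ i ∈ Finset.range (N j ω.1),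
      g (U (j, i) ω.2) = Complex.exp ((∑ k, ((∑ j ∈ Finset.range K,
        cellCount (N j ω.1) (fun i => U (j, i) ω.2) (A k) : ℕ) : ℝ) * t k : ℝ) * Complex.I) := by
    intro K ω
    simp only [hgdef]
    simp_rw [← Complex.exp_sum, ← Finset.sum_mul, ← Complex.ofReal_sum]
    congr 3
    simp only [hf, Nat.cast_sum, Finset.sum_mul]
    rw [Finset.sum_comm]
    refine Finset.sum_congr rfl fun j _ => ?_
    rw [Finset.sum_comm]
    refine Finset.sum_congr rfl fun k _ => ?_
    rw [cellCount, Finset.card_filter]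
    push_cast
    rw [Finset.sum_mul]
    refine Finset.sum_congr rfl fun i _ => ?_
    simp [Set.indicator_apply]
  have hlim : Tendsto (fun K => ∫ ω, ∏ j ∈ Finset.range K, ∏ i ∈ Finset.range (N j ω.1),
      g (U (j, i) ω.2) ∂(P₁.prod P₂)) atTop (𝓝 (∫ ω, Complex.exp
        ((∑ k, (pointCount (cellPoint N U) (A k) ω).toNat * t k : ℝ) * Complex.I)
          ∂(P₁.prod P₂))) := by
    refine tendsto_integral_of_dominated_convergence (fun _ => 1) (fun K => ?_)
      (integrable_const _) (fun K => ae_of_all _ fun ω => ?_) ?_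
    · exact (h.measurable_prod_cells hg _).aestronglyMeasurable
    · rw [hcell]
      exact (Complex.norm_exp_ofReal_mul_I _).le
    · filter_upwards [ae_all_iff.2 fun k => h.ae_eventually_pointCount_eq hγ (hA k) (hvol k)]
        with ω hω
      refine tendsto_const_nhds.congr' ?_
      filter_upwards [eventually_all.2 hω] with K hK
      rw [hcell]
      simp_rw [hK, ENat.toNat_natCast]
  refine tendsto_nhds_unique hlim ?_
  simp_rw [h.integral_prod_cells hg hg1, hgint, ← Complex.exp_sum]
  refine (Complex.continuous_exp.tendsto _).comp ?_
  have hsum : ∀ k, Tendsto (fun K => ∑ j ∈ Finset.range K, ((l j * (ρ j).real (A k) : ℝ) : ℂ))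
      atTop (𝓝 ((γ * (volume (A k)).toNNReal : ℝ≥0) : ℂ)) := by
    intro k
    have hne : γ * volume (A k) ≠ ∞ := ENNReal.mul_ne_top ENNReal.coe_ne_top (hvol k).ne
    have h1 := ENNReal.hasSum_toReal ((h.intensity (A k) (hA k)).symm ▸ hne)
    rw [← ENNReal.tsum_toReal_eq fun j => ENNReal.mul_ne_top ENNReal.coe_ne_top (measure_ne_top _ _),
      h.intensity (A k) (hA k)] at h1
    have h2 := (Complex.continuous_ofReal.tendsto _).comp h1.tendsto_sum_nat
    convert h2 using 2
    · simp [measureReal_def]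
    · rw [ENNReal.toReal_mul]
      rfl
  have h3 := tendsto_finsetSum Finset.univ fun k _ =>
    (hsum k).mul_const (Complex.exp (t k * Complex.I) - 1)
  refine h3.congr fun K => ?_
  simp_rw [Finset.sum_mul, Finset.mul_sum]
  rw [Finset.sum_comm]
  refine Finset.sum_congr rfl fun j _ => Finset.sum_congr rfl fun k _ => ?_
  push_cast
  ring

end CellModel

/-! ### Existence of ball models -/

/-- Lifting the index type places the probability space in the universe over which the theorem
quantifies. -/
lemma exists_iIndepFun_nat {ι E : Type} [MeasurableSpace E] (ρ : ι → Measure E)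
    [∀ i, IsProbabilityMeasure (ρ i)] :
    ∃ (Ω : Type u) (_ : MeasurableSpace Ω) (P : Measure Ω) (_ : IsProbabilityMeasure P)
      (X : ι → Ω → E), (∀ i, Measurable (X i)) ∧ (∀ i, P.map (X i) = ρ i) ∧ iIndepFun X P := by
  obtain ⟨Ω, mΩ, P, X, hX, hlaw, hind, hP⟩ :=
    exists_hasLaw_indepFun (ι := ULift.{u} ι) (fun _ => E) fun i => ρ i.down
  exact ⟨Ω, mΩ, P, hP, fun i => X ⟨i⟩, fun i => hX _, fun i => (hlaw _).map_eq,
    hind.precomp ULift.up_injective⟩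

theorem exists_isStationaryPoisson {γ : ℝ≥0} (hγ : 0 < γ) :
    ∃ (Ω : Type u) (_ : MeasurableSpace Ω) (P : Measure Ω) (_ : IsProbabilityMeasure P)
      (x : ℕ → Ω → Plane), IsStationaryPoisson P γ x := by
  -- The cells are finite measures summing to the area. They need not live on disjoint sets, as only
  -- their sum enters `intensity`.
  set ν : ℕ → Measure Plane := sfiniteSeq volume
  choose ρ hρ hνρ using fun n => exists_eq_smul_isProbabilityMeasure (ν n)
  set l : ℕ → ℝ≥0 := fun n => γ * (ν n Set.univ).toNNReal with hl
  obtain ⟨Ω₁, m₁, P₁, hP₁, N, hN, hNlaw, hNind⟩ :=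
    exists_iIndepFun_nat.{u} fun n => poissonMeasure (l n)
  obtain ⟨Ω₂, m₂, P₂, hP₂, U, hU, hUlaw, hUind⟩ :=
    exists_iIndepFun_nat.{u} fun q : ℕ × ℕ => ρ q.1
  have h : IsCellModel P₁ P₂ γ l ρ N U := by
    refine ⟨hN, hNlaw, hNind, hU, hUlaw, hUind, fun A hA => ?_⟩
    have h1 : ∀ n, (l n : ℝ≥0∞) * ρ n A = γ * ν n A := fun n => by
      conv_rhs => rw [hνρ n]
      rw [Measure.smul_apply, smul_eq_mul, ← mul_assoc, hl]
      push_cast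
      rw [ENNReal.coe_toNNReal (measure_ne_top _ _)]
    simp_rw [h1]
    rw [ENNReal.tsum_mul_left, ← Measure.sum_apply _ hA, sum_sfiniteSeq]
  exact ⟨Ω₁ × Ω₂, inferInstance, P₁.prod P₂, inferInstance, _, h.isStationaryPoisson hγ⟩

section Product

variable {Ω Ω' : Type u} [MeasurableSpace Ω] [MeasurableSpace Ω'] {P : Measure Ω}
  {P' : Measure Ω'} [IsProbabilityMeasure P] [IsProbabilityMeasure P']

omit [IsProbabilityMeasure P] in
lemma iIndepFun_prod_fst {ι : Type*} {E : ι → Type*} [∀ i, MeasurableSpace (E i)]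
    {f : ∀ i, Ω → E i} (h : iIndepFun f P) :
    iIndepFun (fun i (ω : Ω × Ω') => f i ω.1) (P.prod P') := by
  have hfst : ∀ s : Set Ω, (P.prod P') (Prod.fst ⁻¹' s) = P s := fun s => by
    rw [← Set.prod_univ, Measure.prod_prod, measure_univ, mul_one]
  rw [iIndepFun_iff_measure_inter_preimage_eq_mul] at h ⊢
  intro S sets hsets
  have h1 : ⋂ i ∈ S, (fun ω : Ω × Ω' => f i ω.1) ⁻¹' sets i =
      Prod.fst ⁻¹' ⋂ i ∈ S, f i ⁻¹' sets i := by
    ext ω; simp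
  rw [h1, hfst, h S hsets]
  exact Finset.prod_congr rfl fun i _ => (hfst _).symm

lemma iIndepFun_prod_snd {ι : Type*} {E : ι → Type*} [∀ i, MeasurableSpace (E i)]
    {f : ∀ i, Ω' → E i} (h : iIndepFun f P') :
    iIndepFun (fun i (ω : Ω × Ω') => f i ω.2) (P.prod P') := by
  have hsnd : ∀ s : Set Ω', (P.prod P') (Prod.snd ⁻¹' s) = P' s := fun s => by
    rw [← Set.univ_prod, Measure.prod_prod, measure_univ, one_mul]
  rw [iIndepFun_iff_measure_inter_preimage_eq_mul] at h ⊢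
  intro S sets hsets
  have h1 : ⋂ i ∈ S, (fun ω : Ω × Ω' => f i ω.2) ⁻¹' sets i =
      Prod.snd ⁻¹' ⋂ i ∈ S, f i ⁻¹' sets i := by
    ext ω; simp
  rw [h1, hsnd, h S hsets]
  exact Finset.prod_congr rfl fun i _ => (hsnd _).symm

lemma IsStationaryPoisson.prod_fst {γ : ℝ≥0} {x : ℕ → Ω → Plane}
    (hx : IsStationaryPoisson P γ x) :
    IsStationaryPoisson (P.prod P') γ fun i ω => x i ω.1 := by
  refine ⟨fun i => (hx.measurable i).comp measurable_fst, fun A hA hvol k => ?_,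
    fun n A hA hvol hdisj => iIndepFun_prod_fst (hx.count_indep n A hA hvol hdisj)⟩
  rw [← hx.count_law A hA hvol k]
  have : {ω : Ω × Ω' | pointCount (fun i ω => x i ω.1) A ω = k} =
      {ω | pointCount x A ω = k} ×ˢ Set.univ := by
    ext ω; simp [pointCount]
  rw [this, Measure.prod_prod, measure_univ, mul_one]

end Product

theorem exists_isBallModel {γ : ℝ≥0} (hγ : 0 < γ) (μ : Measure ℝ) [IsProbabilityMeasure μ] :
    ∃ (Ω : Type u) (_ : MeasurableSpace Ω) (P : Measure Ω) (_ : IsProbabilityMeasure P)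
      (x : ℕ → Ω → Plane) (r : ℕ → Ω → ℝ), IsBallModel P γ μ x r := by
  obtain ⟨Ω, mΩ, P, hP, x, hx⟩ := exists_isStationaryPoisson.{u} hγ
  obtain ⟨Ω', mΩ', P', hP', r, hr, hrlaw, hrind⟩ := exists_iIndepFun_nat.{u} fun _ : ℕ => μ
  refine ⟨Ω × Ω', inferInstance, P.prod P', inferInstance, fun i ω => x i ω.1,
    fun i ω => r i ω.2, hx.prod_fst, fun i => (hr i).comp measurable_snd, fun i => ?_,
    iIndepFun_prod_snd hrind, ?_⟩
  · rw [← hrlaw i]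
    change (P.prod P').map (r i ∘ Prod.snd) = _
    rw [← Measure.map_map (hr i) measurable_snd, measurePreserving_snd.map_eq]
  · exact indepFun_prod (X := fun ω i => x i ω) (Y := fun ω i => r i ω)
      (measurable_pi_lambda _ hx.measurable) (measurable_pi_lambda _ hr)

end BooleanModel

theorem mainTheorem10
    (W : Set BooleanModel.Plane) (hWcompact : IsCompact W) (hWconvex : Convex ℝ W)
    (hWint : (interior W).Nonempty)
    (μ : Measure ℝ) [IsProbabilityMeasure μ]
    (hμpos : ∃ ε : ℝ, 0 < ε ∧ ∀ᵐ r ∂μ, ε ≤ r)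
    (hμarea : Integrable (fun r : ℝ => r ^ 2) μ)
    (w : Fin 6 → ℝ) :
    (∀ γ : ℝ≥0, 0 < γ →
      ∀ (Ω : Type u) [MeasurableSpace Ω] (P : Measure Ω) [IsProbabilityMeasure P]
        (x : ℕ → Ω → BooleanModel.Plane) (r : ℕ → Ω → ℝ),
        BooleanModel.IsBallModel P γ μ x r →
          BooleanModel.IsAsymptoticallyUnbiasedArea P (BooleanModel.ballUnion x r) W w) ↔
      w 0 = 0 ∧ w 5 = 1 := by
  have hμnonneg : ∀ᵐ r ∂μ, 0 ≤ r := by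
    obtain ⟨ε, hε, h⟩ := hμpos
    exact h.mono fun r hr => hε.le.trans hr
  constructor
  · intro hall
    have heq : ∀ γ : ℝ≥0, 0 < γ → w 0 * (1 - BooleanModel.coverageProb γ μ) +
        w 5 * BooleanModel.coverageProb γ μ = BooleanModel.coverageProb γ μ := by
      intro γ hγ
      obtain ⟨Ω, mΩ, P, hP, x, r, h⟩ := BooleanModel.exists_isBallModel.{u} hγ μ
      exact (h.isAsymptoticallyUnbiasedArea_iff hμnonneg hμarea hWcompact hWint w).1
        (hall γ hγ Ω P x r h)
    -- Any two intensities suffice: w₁ + (w₆ - w₁ - 1) p vanishes at two distinct values of p, so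
    -- slope and constant term are both zero.
    have h1 := heq 1 one_pos
    have h2 := heq 2 two_pos
    have hne : BooleanModel.coverageProb 1 μ - BooleanModel.coverageProb 2 μ ≠ 0 :=
      sub_ne_zero.2 (BooleanModel.coverageProb_ne hμpos hμarea (by norm_num))
    have hslope : w 5 - w 0 - 1 = 0 := by
      refine (mul_eq_zero.1 ?_).resolve_right hne
      linear_combination h1 - h2
    have h0 : w 0 = 0 := by
      linear_combination h1 - BooleanModel.coverageProb 1 μ * hslope
    exact ⟨h0, by linarith⟩
  · rintro ⟨h0, h5⟩ γ _ Ω _ P _ x r h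
    rw [h.isAsymptoticallyUnbiasedArea_iff hμnonneg hμarea hWcompact hWint w, h0, h5]
    ring
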